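/- **Model.** Let $G=(V,E)$ be a finite connected simple graph with maximum degree $\Delta$ whose nodes are anonymous; at each node $v$ the incident edges carry distinct port numbers $0,1,\dots,\deg(v)-1$, chosen arbitrarily and independently at the two ends of an edge. Initially $k\le |V|$ robots are at one source node $s\in V$. The robots have distinct integer labels in $[0,L]$. Each robot knows its own label (as read-only data), but not the labels of the others, nor $k$, $L$, $\Delta$ or $G$. All robots run the same deterministic algorithm in synchronous rounds, with a writable memory that is a bit string, initially empty. At the beginning of each round a robot perceives only: (1) whether it is alone at its node; (2) if it stayed at its node in the previous round, whether the number of robots there increased, and whether it decreased, compared with the previous round; (3) if it entered its node in the previous round, the incoming port and the degree of the node (before the first round: the degree of $s$). From its label, this information and its memory, it computes (by an arbitrary deterministic local computation) its new memory, and it decides to stay or to leave through a port of its node. Robots cannot communicate in any other way, and they do not notice robots that they meet on an edge. Certain memory contents are designated as *idle*; an idle robot never moves or changes its memory again. The algorithm has *terminated* when all robots are idle, and the *additional memory* of a robot is the number of bits in its writable memory. **Theorem.** There are a deterministic algorithm in this model and a constant $C$ such that for all $G$, all port numberings, all $s$, $k$, $L$ and all labels as above, the algorithm terminates, with all $k$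 robots at pairwise distinct nodes, after at most $$C\left(k\log (L+2)+k^2\log(\Delta+2)\right)$$ rounds, and the additional memory of each robot at the beginning of every round is at most $C\left(\log (L+2)+\log(\Delta+2)\right)$ bits. In particular, for $L,\Delta\ge 2$ it achieves dispersion in $O(k\log L+k^2\log\Delta)$ rounds, with $O(\log L+\log\Delta)$ bits of additional memory per robot. -/

import Mathlib

namespace SilentDispersion

/-- A port labelling of an anonymous graph: at every node `v` of degree `d`, the edges incident to
`v` carry the distinct port numbers `0, ..., d - 1`, independently of the other end of the edge. -/
structure PortLabelling {V : Type*} [Fintype V] (G : SimpleGraph V) [DecidableRel G.Adj] where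
  /-- the neighbour of `v` that is reached through a given port of `v` -/
  nbr : ∀ v : V, Fin (G.degree v) ≃ G.neighborSet v

/-- Everything that a silent robot perceives at the beginning of a round. -/
structure Observation where
  /-- the robot is the only robot at its current node -/
  alone : Bool
  /-- the robot stayed in the previous round and the number of robots at its node went up -/
  increase : Bool
  /-- the robot stayed in the previous round and the number of robots at its node went down -/
  decrease : Bool
  /-- the incoming port, if the robot entered its node in the previous round -/
  inPort : Option ℕ
  /-- the degree of the node, if the robot entered it in the previous round
  (or has just been placed on it, before the first round) -/
  degree : Option ℕ

/-- A deterministic algorithm for silent robots. All robots run the same algorithm. The writable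
memory of a robot is a bit string, and its label is available as read-only data. In each
round a robot computes, from its label, what it perceives and its memory, its new memory and its
move: `none` is the decision to stay, `some p` the decision to leave through port `p`.
A robot whose memory satisfies `idle` no longer takes part. -/
structure Algorithm where
  idle : List Bool → Bool
  step : (label : ℕ) → Observation → (memory : List Bool) → List Bool × Option ℕ

/-- A global configuration of `k` robots at the beginning of a round. -/
structure Config (V : Type*) (k : ℕ) where
  pos : Fin k → V
  mem : Fin k → List Bool
  obs : Fin k → Observation

/-- The number of robots at node `v`. -/
def occupancy {V : Type*} [DecidableEq V] {k : ℕ} (pos : Fin k → V) (v : V) : ℕ :=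
  (Finset.univ.filter fun r => pos r = v).card

section Model

variable {V : Type*} [Fintype V] [DecidableEq V] {G : SimpleGraph V} [DecidableRel G.Adj]

/-- The effect of a move decided at node `v`: the new node, together with the incoming port if an
edge is traversed. A port number that does not exist at `v` has the effect of staying. -/
def PortLabelling.traverse (P : PortLabelling G) (v : V) : Option ℕ → V × Option ℕ
  | none => (v, none)
  | some p =>
    if h : p < G.degree v then
      let w := P.nbr v ⟨p, h⟩
      (w.1, some ((P.nbr w.1).symm ⟨v, SimpleGraph.Adj.symm w.2⟩ : ℕ))
    else (v, none)

/-- The initial configuration: all robots are at the source `s`, with empty memory. -/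
def initial (G : SimpleGraph V) [DecidableRel G.Adj] (s : V) (k : ℕ) : Config V k where
  pos _ := s
  mem _ := []
  obs _ :=
    { alone := decide (k = 1)
      increase := false
      decrease := false
      inPort := none
      degree := some (G.degree s) }

/-- The new memory and the move of robot `r` in one round; idle robots stay and change nothing. -/
def Algorithm.decision (A : Algorithm) {k : ℕ} (label : Fin k → ℕ) (c : Config V k) (r : Fin k) :
    List Bool × Option ℕ :=
  if A.idle (c.mem r) then (c.mem r, none) else A.step (label r) (c.obs r) (c.mem r)

/-- One synchronous round. -/
def Algorithm.round (A : Algorithm) (P : PortLabelling G) {k : ℕ} (label : Fin k → ℕ)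
    (c : Config V k) : Config V k :=
  let out : Fin k → V × Option ℕ := fun r => P.traverse (c.pos r) (A.decision label c r).2
  let pos' : Fin k → V := fun r => (out r).1
  { pos := pos'
    mem := fun r => (A.decision label c r).1
    obs := fun r =>
      { alone := decide (occupancy pos' (pos' r) = 1)
        increase := (out r).2.isNone &&
          decide (occupancy c.pos (pos' r) < occupancy pos' (pos' r))
        decrease := (out r).2.isNone &&
          decide (occupancy pos' (pos' r) < occupancy c.pos (pos' r))
        inPort := (out r).2
        degree := if (out r).2.isSome then some (G.degree (pos' r)) else none } }

/-- The configuration after `t` rounds, with all robots starting at `s`. -/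
def Algorithm.run (A : Algorithm) (P : PortLabelling G) (s : V) {k : ℕ} (label : Fin k → ℕ) :
    ℕ → Config V k
  | 0 => initial G s k
  | t + 1 => A.round P label (A.run P s label t)

/-- The algorithm has terminated: every robot is idle. -/
def Algorithm.Terminated (A : Algorithm) {k : ℕ} (c : Config V k) : Prop :=
  ∀ r, A.idle (c.mem r) = true

/-- The robots are dispersed: no two of them are at the same node. -/
def Dispersed {k : ℕ} (c : Config V k) : Prop :=
  Function.Injective c.pos

end Model

end SilentDispersion

/-! Timing replaces communication: in a fixed round of a protocol, being alone or seeing the number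
of robots change carries one bit.

While all robots are at the source, a yes/no question about the set of labels costs two rounds:
robots that answer yes step through port 0 and come back, and the others see the decrease
(`Swarm.Asking.two_rounds`). Doubling yields a power of two above all labels, and repeated binary
search lists the labels in increasing order with O(log L) questions each (`Query.Valid.next`). So
every robot learns its rank and k in O(k log L) rounds.

Then a depth-first search runs in periods of five rounds. Unsettled robots travel as a group, and at
each new node the one of lowest rank settles; the robot of highest rank is the scout. The settled
robot of the current node counts the unexamined ports. The scout probes a port: if it is alone
there, the node is new, and the group follows because nobody came back; otherwise its return is seen
as an increase. When no port is left, the settled robot steps out for a round, and this decrease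
orders a retreat to the parent. Once the scout has settled, a notification runs up the path and
makes the waiting robots idle (`Search.Notify.exists_idle`).

The group does not store the path. Ports are examined cyclically from the successor of the entry
port, so the parent port comes last, and after a retreat the entry port determines the next port to
examine (`Linked`).

Different ports lead to different neighbours, so no node has more examined ports than there are
settled robots (`Search.Inv.degree_le`). Hence the potential `Search.remaining`, which starts at
O(k²), drops in every period. The search cannot run out of ports at the source too early, since the
occupied set would then be closed under adjacency, hence all of V (`Search.Inv.rest_ne_nil`). A
state consists of at most eight numbers that are O(L + Δ), which gives the memory bound. -/

namespace SilentDispersion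

/-! ### Port labellings -/

section Ports

variable {V : Type*} [Fintype V] [DecidableEq V] {G : SimpleGraph V} [DecidableRel G.Adj]
  (P : PortLabelling G)

omit [DecidableEq V] in
@[simp] theorem PortLabelling.traverse_none (v : V) : P.traverse v none = (v, none) := rfl

omit [DecidableEq V] in
/-- Traversing an existing port leads to a neighbour, and the incoming port leads back. -/
theorem PortLabelling.traverse_port {v : V} {p : ℕ} (hp : p < G.degree v) :
    ∃ w q, P.traverse v (some p) = (w, some q) ∧ G.Adj v w ∧ q < G.degree w ∧
      P.traverse w (some q) = (v, some p) := by
  refine ⟨(P.nbr v ⟨p, hp⟩).1, _, by simp only [traverse, dif_pos hp]; rfl, (P.nbr v ⟨p, hp⟩).2,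
    Fin.is_lt _, ?_⟩
  have hw := (P.nbr v ⟨p, hp⟩).2
  -- The type of `P.nbr y.1` depends on `y`, so the round trip cannot simply be rewritten;
  -- generalising over the neighbour allows substitution.
  have key : ∀ y : G.neighborSet (P.nbr v ⟨p, hp⟩).1, y = ⟨v, SimpleGraph.Adj.symm hw⟩ →
      (y.1, some ((P.nbr y.1).symm ⟨_, SimpleGraph.Adj.symm y.2⟩ : ℕ)) = (v, some p) := by
    rintro _ rfl
    exact congrArg (fun i : Fin (G.degree v) => (v, some (i : ℕ)))
      ((P.nbr v).symm_apply_apply ⟨p, hp⟩)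
  simp only [traverse, Fin.is_lt, dif_pos]
  exact key _ (by simp)

omit [DecidableEq V] in
theorem PortLabelling.exists_port {v w : V} (h : G.Adj v w) :
    ∃ p < G.degree v, (P.traverse v (some p)).1 = w := by
  refine ⟨(P.nbr v).symm ⟨w, h⟩, Fin.is_lt _, ?_⟩
  simp [traverse]

omit [DecidableEq V] in
/-- An incoming port is smaller than the degree of the node that is entered. -/
theorem PortLabelling.inPort_lt {v : V} {m : Option ℕ} {q : ℕ}
    (h : (P.traverse v m).2 = some q) : q < G.degree (P.traverse v m).1 := by
  cases m with
  | none => simp at h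
  | some p =>
    by_cases hp : p < G.degree v
    · obtain ⟨w, q', h1, -, h2, -⟩ := P.traverse_port hp
      rw [h1] at h ⊢
      simp only [Option.some.injEq] at h
      exact h ▸ h2
    · simp [traverse, hp] at h

end Ports

/-! ### Comparing the numbers of robots at a node -/

section Occupancy

variable {V : Type*} [DecidableEq V] {k : ℕ} {pos pos' : Fin k → V} {v : V}

theorem occupancy_le (h : ∀ r, pos r = v → pos' r = v) : occupancy pos v ≤ occupancy pos' v :=
  Finset.card_le_card fun r => by simpa using h r

theorem occupancy_lt (h : ∀ r, pos r = v → pos' r = v) (r : Fin k) (hr : pos r ≠ v)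
    (hr' : pos' r = v) : occupancy pos v < occupancy pos' v :=
  Finset.card_lt_card ⟨fun r => by simpa using h r,
    fun H => hr (by simpa using H (x := r) (by simpa))⟩

theorem occupancy_eq_one_iff (r : Fin k) (hr : pos r = v) :
    occupancy pos v = 1 ↔ ∀ r', pos r' = v → r' = r := by
  rw [occupancy, Finset.card_eq_one]
  constructor
  · rintro ⟨a, ha⟩ r' hr'
    have h1 : r ∈ ({a} : Finset (Fin k)) := ha ▸ by simpa using hr
    have h2 : r' ∈ ({a} : Finset (Fin k)) := ha ▸ by simpa using hr'
    rw [Finset.mem_singleton] at h1 h2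
    rw [h1, h2]
  · intro h
    refine ⟨r, ?_⟩
    ext r'
    simp only [Finset.mem_filter, Finset.mem_univ, true_and, Finset.mem_singleton]
    exact ⟨h r', fun e => e ▸ hr⟩

end Occupancy

/-! ### The states of a robot -/

/-- The five rounds of a period of the depth-first search. -/
inductive Slot
  | signal | scout | report | move | arrive

def Slot.next : Slot → Slot
  | signal => scout
  | scout => report
  | report => move
  | move => arrive
  | arrive => signal

/-- The intention of an unsettled robot: to examine a port, to go back to the parent node, or to
enter a node that has just been discovered. -/
inductive Mode
  | scan | back | fresh

/-- The questions about the set of all labels that are asked while the robots are ranked. -/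
inductive Query
  | double (m : ℕ)
  | search (m a j c : ℕ)

/-- The robots that answer a question affirmatively. -/
def Query.asks (x : ℕ) : Query → Bool
  | double m => decide (2 ^ m ≤ x)
  | search _ a 0 _ => decide (a < x)
  | search _ a (j + 1) _ => decide (a ≤ x ∧ x < a + 2 ^ j)

/-- The question that follows a given answer. -/
def Query.next (ans : Bool) : Query → Option Query
  | double m => some (if ans then double (m + 1) else search m 0 m 0)
  | search m a 0 c => if ans then some (search m (a + 1) m (c + 1)) else none
  | search m a (j + 1) c => some (search m (if ans then a else a + 2 ^ j) j c)

/-- The number of labels smaller than `x` that have been found, updated from `rk`. -/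
def Query.rank (x rk : ℕ) : Query → ℕ
  | search _ a 0 _ => if a < x then rk + 1 else rk
  | _ => rk

/-- The number of labels that have been found, including the current one. -/
def Query.total : Query → ℕ
  | search _ _ _ c => c + 1
  | _ => 0

/-- The data of an unsettled robot: whether it is the scout, its rank, the number of settled
robots, the port to be examined, and the degree of the current node. -/
structure Traveller where
  scout : Bool
  rank : ℕ
  settled : ℕ
  port : ℕ
  degree : ℕ

/-- `host` is the settled robot of the current node and `waiting` one at an ancestor. A `notifier`
brings its parent the news that the last robot has settled, and is `returning` while it is there.
`rem` counts the ports still to be examined; `par` is the parent port. -/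
inductive State
  | start
  | idle
  | query (q : Query) (deg rk : ℕ)
  | answer (q : Query) (deg rk : ℕ)
  | member (slot : Slot) (mode : Mode) (d : Traveller)
  | host (slot : Slot) (rem : ℕ) (par : Option ℕ)
  | waiting (slot : Slot) (rem : ℕ) (par : Option ℕ)
  | notifier (slot : Slot) (port : ℕ)
  | returning

/-- The cyclic successor of a port at a node of degree `d`. -/
def nextPort (p d : ℕ) : ℕ := if p + 1 < d then p + 1 else 0

theorem nextPort_eq_mod {p d : ℕ} (h : p < d) : nextPort p d = (p + 1) % d := by
  unfold nextPort
  split_ifs with h1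
  · rw [Nat.mod_eq_of_lt h1]
  · rw [show p + 1 = d by omega, Nat.mod_self]

/-- The first state of the depth-first search, for a robot of rank `rk` among `total` robots. -/
def State.begin (total deg rk : ℕ) : State :=
  if rk = 0 then host .signal deg none
  else member .signal .scan ⟨decide (rk + 1 = total), rk, 1, 0, deg⟩

/-- The new state and the move of a robot in one round. -/
def State.step (x : ℕ) (o : Observation) : State → State × Option ℕ
  | start => if o.alone then (idle, none) else (query (.double 0) (o.degree.getD 0) 0, none)
  | idle => (idle, none)
  | query q deg rk => (answer q deg rk, if q.asks x then some 0 else none)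
  | answer q deg rk =>
    (match q.next (o.inPort.isSome || o.decrease) with
      | some q' => query q' deg (q.rank x rk)
      | none => begin q.total deg (q.rank x rk), o.inPort)
  | member .signal m d => (member .scout m d, none)
  | member .scout _ d =>
    if o.decrease then (member .report .back d, none)
    else (member .report .scan d, if d.scout then some d.port else none)
  | member .report .scan d =>
    if d.scout then
      if o.alone then
        -- The settled robots are those of rank below `settled`, so this tests whether the scout is
        -- the only unsettled robot.
        (if d.rank ≤ d.settled then notifier .move (o.inPort.getD 0)
          else member .move .fresh { d with
            settled := d.settled + 1
            port := nextPort (o.inPort.getD 0) (o.degree.getD 0)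
            degree := o.degree.getD 0 }, none)
      else (member .move .scan d, o.inPort)
    else (member .move .scan d, none)
  | member .report m d => (member .move m d, none)
  -- For a robot other than the scout, an increase means that the scout is back from an occupied
  -- node; without one it follows the scout.
  | member .move .scan d =>
    if d.scout || o.increase then
      (member .arrive .scan { d with port := nextPort d.port d.degree }, none)
    else (member .arrive .fresh d, some d.port)
  | member .move .back d => (member .arrive .back d, some d.port)
  | member .move .fresh d => (member .arrive .scan d, none)
  | member .arrive .scan d => (member .signal .scan d, none)
  | member .arrive .back d =>
    (member .signal .scan { d with
      port := nextPort (o.inPort.getD 0) (o.degree.getD 0)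
      degree := o.degree.getD 0 }, none)
  | member .arrive .fresh d =>
    (if d.rank ≤ d.settled then host .signal (o.degree.getD 0 - 1) o.inPort
      else member .signal .scan { d with
        settled := d.settled + 1
        port := nextPort (o.inPort.getD 0) (o.degree.getD 0)
        degree := o.degree.getD 0 }, none)
  | host .signal rem par => (host .scout rem par, if rem = 0 then some 0 else none)
  | host .scout rem par => (host .report rem par, o.inPort)
  | host .move rem par =>
    (if rem = 0 then idle
      else if o.increase then host .arrive (rem - 1) par else waiting .arrive (rem - 1) par, none)
  | host s rem par => (host s.next rem par, none)
  -- The slot distinguishes the visitors: an increase seen in slot `move` is a notification, one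
  -- seen in slot `arrive` is the group retreating from a child.
  | waiting .move rem par =>
    (if o.increase then par.elim idle (notifier .arrive) else waiting .arrive rem par, none)
  | waiting .arrive rem par =>
    (if o.increase then host .signal rem par else waiting .signal rem par, none)
  | waiting s rem par => (waiting s.next rem par, none)
  | notifier .report p => (returning, some p)
  | notifier s p => (notifier s.next p, none)
  | returning => (idle, o.inPort)

/-! ### Encoding of the states as bit strings -/

def Slot.code : Slot → ℕ
  | signal => 0 | scout => 1 | report => 2 | move => 3 | arrive => 4

def Mode.code : Mode → ℕ
  | scan => 0 | back => 1 | fresh => 2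

def portCode : Option ℕ → ℕ
  | none => 0
  | some p => p + 1

def Query.code : Query → List ℕ
  | double m => [0, m]
  | search m a j c => [1, m, a, j, c]

def State.code : State → List ℕ
  | start => []
  | idle => [1]
  | query q deg rk => 2 :: deg :: rk :: q.code
  | answer q deg rk => 3 :: deg :: rk :: q.code
  | member s m d => [4, s.code, m.code, d.scout.toNat, d.rank, d.settled, d.port, d.degree]
  | host s rem par => [5, s.code, rem, portCode par]
  | waiting s rem par => [6, s.code, rem, portCode par]
  | notifier s p => [7, s.code, p]
  | returning => [8]

theorem Slot.code_injective : Function.Injective Slot.code := by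
  intro a b h; cases a <;> cases b <;> simp_all [Slot.code]

theorem Mode.code_injective : Function.Injective Mode.code := by
  intro a b h; cases a <;> cases b <;> simp_all [Mode.code]

theorem portCode_injective : Function.Injective portCode := by
  intro a b h; cases a <;> cases b <;> simp_all [portCode]

theorem Query.code_injective : Function.Injective Query.code := by
  intro a b h; cases a <;> cases b <;> simp_all [Query.code]

theorem State.code_injective : Function.Injective State.code := by
  have hb : ∀ a b : Bool, a.toNat = b.toNat → a = b := by decide
  intro a b h
  cases a <;> cases b <;> simp only [State.code, List.cons.injEq, reduceCtorEq, and_true,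
    Nat.reduceEqDiff, false_and, true_and] at h ⊢ <;> try contradiction
  · obtain ⟨h1, h2, h3⟩ := h
    rw [h1, h2, Query.code_injective h3]
  · obtain ⟨h1, h2, h3⟩ := h
    rw [h1, h2, Query.code_injective h3]
  · rename_i d _ _ d'
    obtain ⟨h1, h2, h3, h4, h5, h6, h7⟩ := h
    cases d; cases d'
    simp only at *
    rw [Slot.code_injective h1, Mode.code_injective h2, hb _ _ h3, h4, h5, h6, h7]
  · obtain ⟨h1, h2, h3⟩ := h
    rw [Slot.code_injective h1, h2, portCode_injective h3]
  · obtain ⟨h1, h2, h3⟩ := h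
    rw [Slot.code_injective h1, h2, portCode_injective h3]
  · obtain ⟨h1, h2⟩ := h
    rw [Slot.code_injective h1, h2]

theorem State.code_length_le (s : State) : s.code.length ≤ 8 := by
  cases s <;> simp [State.code]
  all_goals rename_i q _ _; cases q <;> simp [Query.code]

/-- A list of natural numbers as a single number. -/
def listCode : List ℕ → ℕ
  | [] => 0
  | x :: l => Nat.pair x (listCode l) + 1

theorem listCode_injective : Function.Injective listCode := by
  intro a
  induction a with
  | nil => intro b h; cases b <;> simp_all [listCode]
  | cons x l ih =>
    intro b h
    cases b with
    | nil => simp [listCode] at h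
    | cons y l' =>
      simp only [listCode, Nat.add_right_cancel_iff, Nat.pair_eq_pair] at h
      rw [h.1, ih h.2]

/-- Pairing at most squares the size, and a third factor absorbs the successor; hence the powers of
3. As codes have bounded length, the exponent is a constant. -/
theorem listCode_lt {B : ℕ} (l : List ℕ) (h : ∀ x ∈ l, x ≤ B) :
    listCode l < (B + 2) ^ 3 ^ l.length := by
  induction l with
  | nil => simp [listCode]
  | cons x l ih =>
    have h1 := ih fun y hy => h y (by simp [hy])
    have h2 : x ≤ B := h x (by simp)
    set e := 3 ^ l.length with he
    have he1 : 1 ≤ e := Nat.one_le_pow _ _ (by norm_num)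
    have h3 : B + 2 ≤ (B + 2) ^ e := Nat.le_self_pow (by omega) _
    have h4 : Nat.pair x (listCode l) < ((B + 2) ^ e) ^ 2 :=
      (Nat.pair_lt_max_add_one_sq _ _).trans_le (Nat.pow_le_pow_left (by omega) 2)
    have h5 : (B + 2) ^ 3 ^ (x :: l).length = ((B + 2) ^ e) ^ 2 * (B + 2) ^ e := by
      rw [List.length_cons, pow_succ 3, ← he, pow_mul, ← pow_succ]
    rw [h5, listCode]
    nlinarith

/-- The memory contents of a robot in a given state. -/
def State.memory (s : State) : List Bool := (listCode s.code).bits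

theorem State.memory_injective : Function.Injective State.memory := by
  intro a b h
  have h2 : listCode a.code = listCode b.code := by
    refine Nat.eq_of_testBit_eq fun i => ?_
    rw [Nat.testBit_eq_inth, Nat.testBit_eq_inth]
    exact congrArg (fun l => List.getI l i) h
  exact State.code_injective (listCode_injective h2)

theorem State.memory_length_le {B : ℕ} {s : State} (h : ∀ x ∈ s.code, x ≤ B) :
    (s.memory.length : ℝ) ≤ 3 ^ 8 * Real.log (B + 2) / Real.log 2 + 1 := by
  have h1 : listCode s.code < (B + 2) ^ 3 ^ 8 := (listCode_lt _ h).trans_le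
    (Nat.pow_le_pow_right (by omega) (Nat.pow_le_pow_right (by norm_num) s.code_length_le))
  have h2 : 0 < Real.log 2 := Real.log_pos (by norm_num)
  rw [State.memory, Nat.size_eq_bits_len]
  rcases Nat.eq_zero_or_pos (Nat.size (listCode s.code)) with h0 | h0
  · rw [h0]
    have : 0 ≤ Real.log ((B : ℝ) + 2) := Real.log_nonneg (by linarith [B.cast_nonneg (α := ℝ)])
    rw [Nat.cast_zero]
    positivity
  · have h3 : 2 ^ (Nat.size (listCode s.code) - 1) < (B + 2) ^ 3 ^ 8 :=
      (Nat.lt_size.mp (by omega)).trans_lt h1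
    have h4 : ((2 : ℝ)) ^ (Nat.size (listCode s.code) - 1) ≤ ((B : ℝ) + 2) ^ 3 ^ 8 := by
      exact_mod_cast h3.le
    have h5 := Real.log_le_log (by positivity) h4
    rw [Real.log_pow, Real.log_pow, Nat.cast_sub h0] at h5
    rw [← sub_le_iff_le_add, le_div_iff₀ h2]
    exact_mod_cast h5

/-! ### The algorithm -/

instance : Nonempty State := ⟨.start⟩

open Classical in
/-- The algorithm for silent robots: the memory of a robot is the encoding of its state. -/
noncomputable def algorithm : Algorithm where
  idle m := decide (m = State.idle.memory)
  step x o m :=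
    let out := (Function.invFun State.memory m).step x o
    (out.1.memory, out.2)

/-- A configuration of `k` robots in terms of their states. -/
structure Swarm (V : Type*) (k : ℕ) where
  pos : Fin k → V
  st : Fin k → State
  obs : Fin k → Observation

section Swarm

variable {V : Type*} [Fintype V] [DecidableEq V] {G : SimpleGraph V} [DecidableRel G.Adj]
  (P : PortLabelling G) {k : ℕ} (label : Fin k → ℕ)

def Swarm.config (c : Swarm V k) : Config V k := ⟨c.pos, fun r => (c.st r).memory, c.obs⟩

/-- The state and the move of a robot that result from a round. -/
def Swarm.out (c : Swarm V k) (r : Fin k) : State × Option ℕ := (c.st r).step (label r) (c.obs r)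

/-- The place of a robot after a round, and its incoming port. -/
def Swarm.dest (c : Swarm V k) (r : Fin k) : V × Option ℕ :=
  P.traverse (c.pos r) (c.out label r).2

def Swarm.round (c : Swarm V k) : Swarm V k where
  pos r := (c.dest P label r).1
  st r := (c.out label r).1
  obs r :=
    let pos' : Fin k → V := fun r => (c.dest P label r).1
    { alone := decide (occupancy pos' (pos' r) = 1)
      increase := (c.dest P label r).2.isNone &&
        decide (occupancy c.pos (pos' r) < occupancy pos' (pos' r))
      decrease := (c.dest P label r).2.isNone &&
        decide (occupancy pos' (pos' r) < occupancy c.pos (pos' r))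
      inPort := (c.dest P label r).2
      degree := if (c.dest P label r).2.isSome then some (G.degree (pos' r)) else none }

omit [Fintype V] [DecidableEq V] in
-- Since `State.memory` is injective, `Function.invFun` really decodes. The model's special
-- treatment of idle robots agrees with `State.step`, which fixes `idle`.
theorem algorithm_decision (c : Swarm V k) (r : Fin k) :
    algorithm.decision label c.config r = ((c.out label r).1.memory, (c.out label r).2) := by
  by_cases h : c.st r = .idle
  · simp [Algorithm.decision, algorithm, Swarm.config, Swarm.out, h, State.step]
  · have h2 : (c.st r).memory ≠ State.idle.memory := fun e => h (State.memory_injective e)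
    simp [Algorithm.decision, algorithm, Swarm.config, Swarm.out, h2,
      Function.leftInverse_invFun State.memory_injective _]

theorem algorithm_round (c : Swarm V k) :
    algorithm.round P label c.config = (c.round P label).config := by
  unfold Algorithm.round
  rw [show algorithm.decision label c.config = fun r => ((c.out label r).1.memory,
    (c.out label r).2) from funext (algorithm_decision label c)]
  rfl

/-- The initial configuration. -/
def Swarm.init (G : SimpleGraph V) [DecidableRel G.Adj] (s : V) (k : ℕ) : Swarm V k :=
  ⟨fun _ => s, fun _ => .start, (initial G s k).obs⟩

/-- The configuration after `t` rounds. -/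
def Swarm.after (s : V) (t : ℕ) : Swarm V k := (Swarm.round P label)^[t] (Swarm.init G s k)

/-- The empty initial memory is the encoding of `start`; from there the two kinds of rounds
correspond. -/
theorem algorithm_run (s : V) (t : ℕ) :
    algorithm.run P s label t = (Swarm.after P label s t).config := by
  induction t with
  | zero => simp [Algorithm.run, Swarm.after, Swarm.config, Swarm.init, initial, State.memory,
      State.code, listCode]
  | succ t ih =>
    rw [Algorithm.run, ih, algorithm_round, Swarm.after, Swarm.after, Function.iterate_succ_apply']

theorem algorithm_idle (s : State) : algorithm.idle s.memory = true ↔ s = .idle := by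
  simp [algorithm, State.memory_injective.eq_iff]

end Swarm

/-! ### Ranking the robots -/

section Ranking

variable {k : ℕ} (label : Fin k → ℕ)

/-- The number of labels below `a`. -/
def countBelow (a : ℕ) : ℕ := (Finset.univ.filter fun r => label r < a).card

theorem countBelow_mono {a b : ℕ} (h : a ≤ b) : countBelow label a ≤ countBelow label b :=
  Finset.card_le_card fun r => by
    simp only [Finset.mem_filter, Finset.mem_univ, true_and]
    omega

theorem countBelow_eq_of_forall {a b : ℕ} (h : ∀ r, label r < a ↔ label r < b) :
    countBelow label a = countBelow label b := by
  unfold countBelow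
  congr 1
  ext r
  simp [h]

theorem countBelow_succ {r : Fin k} (hl : Function.Injective label) :
    countBelow label (label r + 1) = countBelow label (label r) + 1 := by
  unfold countBelow
  rw [← Finset.card_insert_of_notMem (a := r) (by simp)]
  congr 1
  ext r'
  simp only [Finset.mem_filter, Finset.mem_univ, true_and, Finset.mem_insert]
  rw [← hl.eq_iff]
  omega

theorem countBelow_lt {a : ℕ} {r : Fin k} (h : a ≤ label r) : countBelow label a < k := by
  have h1 : countBelow label a < (Finset.univ : Finset (Fin k)).card :=
    Finset.card_lt_card ⟨Finset.filter_subset _ _, fun H => by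
      have h2 := H (Finset.mem_univ r)
      simp only [Finset.mem_filter, Finset.mem_univ, true_and] at h2
      omega⟩
  simpa using h1

theorem countBelow_eq {a : ℕ} (h : ∀ r, label r < a) : countBelow label a = k := by
  simp [countBelow, h]

theorem countBelow_le (a : ℕ) : countBelow label a ≤ k :=
  (Finset.card_filter_le _ _).trans (by simp)

theorem countBelow_label_injective (hl : Function.Injective label) :
    Function.Injective fun r => countBelow label (label r) := by
  have key : ∀ r r', label r < label r' →
      countBelow label (label r) < countBelow label (label r') := fun r r' h => by
    have h1 := countBelow_succ label (r := r) hl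
    have h2 := countBelow_mono label (show label r + 1 ≤ label r' from h)
    omega
  intro r r' h
  simp only at h
  rcases lt_trichotomy (label r) (label r') with h1 | h1 | h1
  · have := key _ _ h1; omega
  · exact hl h1
  · have := key _ _ h1; omega

/-- What is known about the labels when a question is asked; `rk` counts, for each robot, the
smaller labels that have been found. -/
def Query.Valid (L : ℕ) (q : Query) (rk : Fin k → ℕ) : Prop :=
  match q with
  | .double m => 2 ^ m ≤ 2 * (L + 1) ∧ ∀ r, rk r = 0
  | .search m a j c => 2 ^ m ≤ 2 * (L + 1) ∧ (∀ r, label r < 2 ^ m) ∧ j ≤ m ∧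
      (∃ r, a ≤ label r ∧ label r < a + 2 ^ j) ∧ c = countBelow label a ∧
      ∀ r, rk r = countBelow label (min a (label r))

/-- A bound for the number of questions that remain to be asked. -/
def Query.remaining (L k : ℕ) : Query → ℕ
  | .double m => Nat.log 2 (2 * (L + 1)) - m + 1 + k * (Nat.log 2 (2 * (L + 1)) + 1)
  | .search _ _ j c => (k - c - 1) * (Nat.log 2 (2 * (L + 1)) + 1) + j + 1

/-- The truthful answer to a question. -/
def Query.truth (q : Query) : Bool := decide (∃ r, q.asks (label r) = true)

theorem Query.truth_eq_true {q : Query} : q.truth label = true ↔ ∃ r, q.asks (label r) = true := by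
  simp [truth]

theorem Query.truth_eq_false {q : Query} :
    q.truth label = false ↔ ∀ r, q.asks (label r) = false := by
  simp [truth]

variable {label} {L : ℕ} {q : Query} {rk : Fin k → ℕ}

/-- A search keeps an interval of length `2 ^ j` from `a` that contains a label, and prefers its
left half, so it converges to the least label that is at least `a`. At `j = 0` the number `a` is
itself a label, and the question is whether a larger one exists; if so, the search restarts at `a +
1`. Each label thus uses up at most one block of `Nat.log 2 (2 * (L + 1)) + 1` questions. -/
theorem Query.Valid.next (hl : Function.Injective label) (hk : 0 < k) (hL : ∀ r, label r ≤ L)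
    (h : q.Valid label L rk) {q' : Query} (hq : q.next (q.truth label) = some q') :
    q'.Valid label L (fun r => q.rank (label r) (rk r)) ∧
      q'.remaining L k < q.remaining L k := by
  have hlog : ∀ m, 2 ^ m ≤ 2 * (L + 1) → m ≤ Nat.log 2 (2 * (L + 1)) := fun m hm =>
    (Nat.le_log_iff_pow_le (by norm_num) (by omega)).2 hm
  cases ht : q.truth label
  · rw [ht] at hq
    have hf := (Query.truth_eq_false label).1 ht
    match q with
    | .double m =>
      simp only [Query.next, Option.some.injEq, Bool.false_eq_true, if_false] at hq
      subst hq
      simp only [Query.asks, decide_eq_false_iff_not, not_le] at hf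
      refine ⟨⟨h.1, hf, le_rfl, ⟨⟨0, hk⟩, Nat.zero_le _, by simpa using hf ⟨0, hk⟩⟩, ?_, ?_⟩, ?_⟩
      · simp [countBelow]
      · intro r
        simp [countBelow, Query.rank, h.2 r]
      · have := hlog m h.1
        simp only [Query.remaining]
        obtain ⟨k, rfl⟩ : ∃ n, k = n + 1 := ⟨k - 1, by omega⟩
        simp only [Nat.sub_zero, Nat.add_sub_cancel]
        rw [Nat.add_mul]
        omega
    | .search m a 0 c => simp [Query.next] at hq
    | .search m a (j + 1) c =>
      simp only [Query.next, Option.some.injEq, Bool.false_eq_true, if_false] at hq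
      subst hq
      simp only [Query.asks, decide_eq_false_iff_not] at hf
      obtain ⟨h1, h2, h3, ⟨r, h4, h4'⟩, h5, h6⟩ := h
      have hiff : ∀ r, label r < a ↔ label r < a + 2 ^ j := fun r => by
        have := hf r
        omega
      refine ⟨⟨h1, h2, by omega, ⟨r, ?_, ?_⟩, ?_, ?_⟩, ?_⟩
      · have := hf r
        omega
      · rw [pow_succ] at h4'
        omega
      · rw [h5, countBelow_eq_of_forall label hiff]
      · intro r'
        simp only [Query.rank]
        rw [h6]
        refine countBelow_eq_of_forall label fun r'' => ?_
        have := hiff r''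
        simp only [lt_min_iff, this]
      · simp only [Query.remaining]
        omega
  · rw [ht] at hq
    obtain ⟨r, hr⟩ := (Query.truth_eq_true label).1 ht
    match q with
    | .double m =>
      simp only [Query.next, Option.some.injEq, if_true] at hq
      subst hq
      simp only [Query.asks, decide_eq_true_eq] at hr
      have h2 : 2 ^ (m + 1) ≤ 2 * (L + 1) := by
        have := hL r
        rw [pow_succ]
        omega
      refine ⟨⟨h2, h.2⟩, ?_⟩
      have := hlog _ h2
      simp only [Query.remaining]
      omega
    | .search m a 0 c =>
      simp only [Query.next, Option.some.injEq, if_true] at hq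
      subst hq
      simp only [Query.asks, decide_eq_true_eq] at hr
      obtain ⟨h1, h2, h3, ⟨r₀, h4, h4'⟩, h5, h6⟩ := h
      obtain rfl : a = label r₀ := by omega
      refine ⟨⟨h1, h2, le_rfl, ⟨r, hr, (h2 r).trans_le (by omega)⟩, ?_, ?_⟩, ?_⟩
      · rw [countBelow_succ label hl, h5]
      · intro r'
        simp only [Query.rank]
        rw [h6]
        split_ifs with h7
        · rw [min_eq_left h7.le, min_eq_left h7, countBelow_succ label hl]
        · rw [min_eq_right (by omega), min_eq_right (by omega)]
      · have h7 := countBelow_lt label (show label r₀ + 1 ≤ label r from hr)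
        rw [countBelow_succ label hl, ← h5] at h7
        have := hlog m h1
        simp only [Query.remaining]
        obtain ⟨e, rfl⟩ : ∃ n, k = n + (c + 2) := ⟨k - (c + 2), by omega⟩
        rw [show e + (c + 2) - (c + 1) - 1 = e by omega, show e + (c + 2) - c - 1 = e + 1 by omega,
          Nat.add_mul e 1]
        omega
    | .search m a (j + 1) c =>
      simp only [Query.next, Option.some.injEq, if_true] at hq
      subst hq
      simp only [Query.asks, decide_eq_true_eq] at hr
      obtain ⟨h1, h2, h3, -, h5, h6⟩ := h
      refine ⟨⟨h1, h2, by omega, ⟨r, hr⟩, h5, h6⟩, ?_⟩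
      simp only [Query.remaining]
      omega

/-- The questions end when no label exceeds the label `a` just found. Then `a` is the maximum, so
all labels have been counted, and `min a (label r)` is `label r`, so the ranks are final. -/
theorem Query.Valid.last (hl : Function.Injective label) (h : q.Valid label L rk)
    (hq : q.next (q.truth label) = none) :
    q.total = k ∧ ∀ r, q.rank (label r) (rk r) = countBelow label (label r) := by
  match q with
  | .double m => simp [Query.next] at hq
  | .search m a (j + 1) c => simp [Query.next] at hq
  | .search m a 0 c =>
    have hf : (Query.search m a 0 c).truth label = false := by
      by_contra hc
      rw [Bool.not_eq_false] at hc
      simp [hc, Query.next] at hq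
    have hf := (Query.truth_eq_false label).1 hf
    simp only [Query.asks, decide_eq_false_iff_not, not_lt] at hf
    obtain ⟨h1, h2, h3, ⟨r₀, h4, h4'⟩, h5, h6⟩ := h
    obtain rfl : a = label r₀ := by omega
    refine ⟨?_, fun r => ?_⟩
    · rw [Query.total, h5, ← countBelow_succ label hl]
      exact countBelow_eq label fun r => by have := hf r; omega
    · have h7 := hf r
      simp only [Query.rank]
      rw [if_neg (by omega), h6, min_eq_right h7]

theorem Query.Valid.code_le (hk : k ≤ L + 1) (hL : ∀ r, label r ≤ L) (h : q.Valid label L rk) :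
    (∀ x ∈ q.code, x ≤ 2 * L + 2) ∧ ∀ r, rk r ≤ 2 * L + 2 := by
  have hm : ∀ m, 2 ^ m ≤ 2 * (L + 1) → m ≤ 2 * L + 2 := fun m hm =>
    (Nat.lt_two_pow_self (n := m)).le.trans (by omega)
  match q with
  | .double m =>
    have := hm m h.1
    refine ⟨by simp [Query.code]; omega, fun r => by rw [h.2 r]; omega⟩
  | .search m a j c =>
    obtain ⟨h1, h2, h3, ⟨r₀, h4, h4'⟩, h5, h6⟩ := h
    have e1 := hm m h1
    have e2 := hL r₀
    have e3 := countBelow_le label a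
    refine ⟨?_, fun r => ?_⟩
    · simp only [Query.code, List.mem_cons, List.not_mem_nil, or_false, forall_eq_or_imp, forall_eq]
      omega
    · have := countBelow_le label (min a (label r))
      rw [h6]
      omega

end Ranking

/-! ### Effects and observations of a single round -/

section Round

variable {V : Type*} [Fintype V] [DecidableEq V] {G : SimpleGraph V} [DecidableRel G.Adj]
  {P : PortLabelling G} {k : ℕ} {label : Fin k → ℕ} {c : Swarm V k} {r : Fin k}

theorem Swarm.round_pos : (c.round P label).pos r = (P.traverse (c.pos r) (c.out label r).2).1 :=
  rfl

theorem Swarm.round_st : (c.round P label).st r = (c.out label r).1 := rfl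

theorem Swarm.round_inPort :
    ((c.round P label).obs r).inPort = (P.traverse (c.pos r) (c.out label r).2).2 := rfl

theorem Swarm.round_degree {q : ℕ} (h : ((c.round P label).obs r).inPort = some q) :
    ((c.round P label).obs r).degree = some (G.degree ((c.round P label).pos r)) := by
  rw [round_inPort] at h
  simp only [Swarm.round, dest, h, Option.isSome_some, if_true]
  rfl

theorem Swarm.round_alone : ((c.round P label).obs r).alone = true ↔
    occupancy (c.round P label).pos ((c.round P label).pos r) = 1 := by
  simp [Swarm.round]

theorem Swarm.round_decrease (h : (c.out label r).2 = none) :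
    ((c.round P label).obs r).decrease = true ↔
      occupancy (c.round P label).pos (c.pos r) < occupancy c.pos (c.pos r) := by
  simp [Swarm.round, dest, h]

theorem Swarm.round_increase (h : (c.out label r).2 = none) :
    ((c.round P label).obs r).increase = true ↔
      occupancy c.pos (c.pos r) < occupancy (c.round P label).pos (c.pos r) := by
  simp [Swarm.round, dest, h]

theorem Swarm.not_decrease (h : occupancy c.pos ((c.round P label).pos r) ≤
    occupancy (c.round P label).pos ((c.round P label).pos r)) :
    ((c.round P label).obs r).decrease = false := by
  simp only [Swarm.round, Bool.and_eq_false_iff, decide_eq_false_iff_not, not_lt]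
  exact Or.inr h

theorem Swarm.not_increase (h : occupancy (c.round P label).pos ((c.round P label).pos r) ≤
    occupancy c.pos ((c.round P label).pos r)) :
    ((c.round P label).obs r).increase = false := by
  simp only [Swarm.round, Bool.and_eq_false_iff, decide_eq_false_iff_not, not_lt]
  exact Or.inr h

end Round

/-! ### Execution of the ranking, two rounds per question -/

section RankingRounds

variable {V : Type*} [Fintype V] [DecidableEq V] {G : SimpleGraph V} [DecidableRel G.Adj]
  {P : PortLabelling G} {k : ℕ} {label : Fin k → ℕ} {c : Swarm V k} {s : V}

/-- All robots are at `s` and ask the question `q`. -/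
def Swarm.Asking (G : SimpleGraph V) [DecidableRel G.Adj] (s : V) (q : Query) (rk : Fin k → ℕ)
    (c : Swarm V k) : Prop :=
  ∀ r, c.pos r = s ∧ c.st r = .query q (G.degree s) (rk r)

/-- A robot that left knows that the answer is yes; one that stayed sees a decrease exactly when
somebody left. In the second round the incoming port leads everyone back to `s`. -/
theorem Swarm.Asking.two_rounds (hs : 0 < G.degree s) {q : Query} {rk : Fin k → ℕ}
    (h : c.Asking G s q rk) :
    (∀ r, (c.round P label).st r = .answer q (G.degree s) (rk r)) ∧
    ∀ r, ((c.round P label).round P label).pos r = s ∧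
      ((c.round P label).round P label).st r = match q.next (q.truth label) with
        | some q' => .query q' (G.degree s) (q.rank (label r) (rk r))
        | none => .begin q.total (G.degree s) (q.rank (label r) (rk r)) := by
  obtain ⟨y, z, hz, hadj, -, hback⟩ := P.traverse_port hs
  have hys : y ≠ s := hadj.ne'
  have hst : ∀ r, (c.round P label).st r = .answer q (G.degree s) (rk r) := fun r => by
    simp [round_st, out, (h r).2, State.step]
  have hout : ∀ r, (c.out label r).2 = if q.asks (label r) then some 0 else none := fun r => by
    simp [out, (h r).2, State.step]
  have hpos : ∀ r, (c.round P label).pos r = if q.asks (label r) then y else s := fun r => by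
    rw [round_pos, hout, (h r).1]
    split_ifs <;> simp [hz]
  have hin : ∀ r, ((c.round P label).obs r).inPort = if q.asks (label r) then some z else none :=
    fun r => by
      rw [round_inPort, hout, (h r).1]
      split_ifs <;> simp [hz]
  have hans : ∀ r, (((c.round P label).obs r).inPort.isSome ||
      ((c.round P label).obs r).decrease) = q.truth label := fun r => by
    rw [hin]
    cases hr : q.asks (label r)
    · rw [Bool.eq_iff_iff, Query.truth_eq_true]
      simp only [Bool.false_eq_true, if_false, Option.isSome_none, Bool.false_or]
      rw [round_decrease (by simp [hout, hr]), (h r).1]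
      constructor
      · intro hlt
        by_contra hno
        push Not at hno
        refine hlt.not_ge (occupancy_le fun r' _ => ?_)
        simp [hpos, hno]
      · rintro ⟨r', hr'⟩
        exact occupancy_lt (fun r' _ => (h r').1) r' (by simp [hpos, hr', hys]) (h r').1
    · simp only [if_true, Option.isSome_some, Bool.true_or]
      exact ((Query.truth_eq_true label).2 ⟨r, hr⟩).symm
  refine ⟨hst, fun r => ⟨?_, ?_⟩⟩
  · rw [round_pos]
    simp only [out, hst, State.step, hin, hpos]
    cases q.asks (label r) <;> simp [hback]
  · rw [round_st]
    simp only [out, hst, State.step, hans]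

/-- After the ranking, all robots are at `s` and begin the depth-first search. Until then the
numbers that they have in their memory are small. -/
theorem Swarm.Asking.exists_begin {L : ℕ} (hs : 0 < G.degree s) (hl : Function.Injective label)
    (hL : ∀ r, label r ≤ L) (hk : k ≤ L + 1) (hk0 : 0 < k) (μ : ℕ) : ∀ {c : Swarm V k} {q : Query}
    {rk : Fin k → ℕ}, q.remaining L k ≤ μ → q.Valid label L rk → c.Asking G s q rk →
    ∃ T ≤ 2 * μ, (∀ r, ((Swarm.round P label)^[T] c).pos r = s ∧
      ((Swarm.round P label)^[T] c).st r =
        .begin k (G.degree s) (countBelow label (label r))) ∧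
      ∀ t < T, ∀ r, ∀ x ∈ (((Swarm.round P label)^[t] c).st r).code,
        x ≤ 2 * L + G.degree s + 8 := by
  induction μ with
  | zero =>
    intro c q rk hμ
    cases q <;> simp [Query.remaining] at hμ
  | succ μ ih =>
    intro c q rk hμ hv h
    obtain ⟨h1, h2⟩ := h.two_rounds (P := P) (label := label) hs
    obtain ⟨hc, hrk⟩ := hv.code_le hk hL
    have hmem : ∀ t < 2, ∀ r, ∀ x ∈ (((Swarm.round P label)^[t] c).st r).code,
        x ≤ 2 * L + G.degree s + 8 := by
      intro t ht r x hx
      have h3 := hrk r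
      have hx : x ≤ 3 ∨ x = G.degree s ∨ x = rk r ∨ x ∈ q.code := by
        interval_cases t
        · simp only [Function.iterate_zero, id, (h r).2, State.code, List.mem_cons] at hx
          exact hx.imp_left fun e => by omega
        · simp only [Function.iterate_one, h1 r, State.code, List.mem_cons] at hx
          exact hx.imp_left fun e => by omega
      rcases hx with hx | hx | hx | hx
      · omega
      · omega
      · omega
      · have := hc x hx
        omega
    cases hq : q.next (q.truth label) with
    | none =>
      simp only [hq] at h2
      obtain ⟨h4, h5⟩ := hv.last hl hq
      exact ⟨2, by omega, fun r => by simpa [h4, h5] using h2 r, hmem⟩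
    | some q' =>
      simp only [hq] at h2
      obtain ⟨h4, h5⟩ := hv.next hl hk0 hL hq
      obtain ⟨T, hT, h6, h7⟩ := ih (by omega) h4 h2
      refine ⟨T + 2, by omega, h6, fun t ht => ?_⟩
      rcases Nat.lt_or_ge t 2 with h8 | h8
      · exact hmem t h8
      · obtain ⟨t, rfl⟩ := Nat.exists_eq_add_of_le' h8
        exact h7 t (by omega)

end RankingRounds

/-! ### Snapshots of the depth-first search -/

/-- A node on the current path of the depth-first search: its settled robot, the number of ports
that remain to be examined, the port of the parent, and the next port to be examined. -/
structure Frame (V : Type*) where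
  rank : ℕ
  node : V
  rem : ℕ
  par : Option ℕ
  port : ℕ

/-- The state of a depth-first search: robots `0, ..., settled - 1` have settled at their homes,
and the path from the source consists of the current node `cur` and its ancestors `rest`. -/
structure Search (V : Type*) where
  settled : ℕ
  home : ℕ → V
  cur : Frame V
  rest : List (Frame V)

section Snap

variable {V : Type*} {k : ℕ}

def Search.path (D : Search V) : List (Frame V) := D.cur :: D.rest

/-- The positions and states of all robots, where `ρ` assigns ranks to them: the settled robot of
the current node, the scout, the other unsettled robots, the settled robots at the ancestors of the
current node, and all others. -/
structure Search.Snap (D : Search V) (ρ : Fin k → ℕ) (host scout : V × State) (crewPos : V)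
    (crew : ℕ → State) (wait : Frame V → State) (c : Swarm V k) : Prop where
  host : ∀ r, ρ r = D.cur.rank → c.pos r = host.1 ∧ c.st r = host.2
  scout : ∀ r, D.settled ≤ ρ r → ρ r + 1 = k → c.pos r = scout.1 ∧ c.st r = scout.2
  crew : ∀ r, D.settled ≤ ρ r → ρ r + 1 ≠ k → c.pos r = crewPos ∧ c.st r = crew (ρ r)
  wait : ∀ r, ∀ f ∈ D.rest, ρ r = f.rank → c.pos r = f.node ∧ c.st r = wait f
  done : ∀ r, ρ r < D.settled → (∀ f ∈ D.path, ρ r ≠ f.rank) →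
    c.pos r = D.home (ρ r) ∧ c.st r = .idle

theorem Search.cases (D : Search V) (k i : ℕ) : i = D.cur.rank ∨ (D.settled ≤ i ∧ i + 1 = k) ∨
    (D.settled ≤ i ∧ i + 1 ≠ k) ∨ (∃ f ∈ D.rest, i = f.rank) ∨
    (i < D.settled ∧ ∀ f ∈ D.path, i ≠ f.rank) := by
  by_cases h1 : i = D.cur.rank
  · exact Or.inl h1
  by_cases h2 : ∃ f ∈ D.rest, i = f.rank
  · exact Or.inr (Or.inr (Or.inr (Or.inl h2)))
  push Not at h2
  have h3 : ∀ f ∈ D.path, i ≠ f.rank := by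
    simp only [path, List.mem_cons, forall_eq_or_imp]
    exact ⟨h1, h2⟩
  rcases Nat.lt_or_ge i D.settled with h4 | h4
  · exact Or.inr (Or.inr (Or.inr (Or.inr ⟨h4, h3⟩)))
  · by_cases h5 : i + 1 = k
    · exact Or.inr (Or.inl ⟨h4, h5⟩)
    · exact Or.inr (Or.inr (Or.inl ⟨h4, h5⟩))

variable {D : Search V} {ρ : Fin k → ℕ} {host scout host' scout' : V × State} {crewPos crewPos' : V}
  {crew crew' : ℕ → State} {wait wait' : Frame V → State} {c c' : Swarm V k}

/-- Robots at ancestors and idle robots stand at the same nodes in any two snapshots of one search,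
so only the three groups that may move need checking. This feeds the comparisons of occupancies. -/
theorem Search.Snap.mono (S : D.Snap ρ host scout crewPos crew wait c)
    (S' : D.Snap ρ host' scout' crewPos' crew' wait' c') {v : V} (hh : host.1 = v → host'.1 = v)
    (hs : scout.1 = v → scout'.1 = v) (hc : crewPos = v → crewPos' = v) (r : Fin k)
    (h : c.pos r = v) : c'.pos r = v := by
  rcases D.cases k (ρ r) with hr | ⟨hr, hr'⟩ | ⟨hr, hr'⟩ | ⟨f, hf, hr⟩ | ⟨hr, hr'⟩
  · rw [(S'.host r hr).1]
    exact hh ((S.host r hr).1 ▸ h)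
  · rw [(S'.scout r hr hr').1]
    exact hs ((S.scout r hr hr').1 ▸ h)
  · rw [(S'.crew r hr hr').1]
    exact hc ((S.crew r hr hr').1 ▸ h)
  · rw [(S'.wait r f hf hr).1, ← (S.wait r f hf hr).1, h]
  · rw [(S'.done r hr hr').1, ← (S.done r hr hr').1, h]

variable [Fintype V] [DecidableEq V] {G : SimpleGraph V} [DecidableRel G.Adj]
  {P : PortLabelling G} {label : Fin k → ℕ}

omit [DecidableEq V] in
-- Reduces a round to one local computation per group; the idle robots need none.
theorem Search.Snap.round [DecidableEq V] (S : D.Snap ρ host scout crewPos crew wait c)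
    (host' scout' : V × State) (crewPos' : V) (crew' : ℕ → State) (wait' : Frame V → State)
    (hh : ∀ r, ρ r = D.cur.rank → ∃ m, host.2.step (label r) (c.obs r) = (host'.2, m) ∧
      (P.traverse host.1 m).1 = host'.1)
    (hs : ∀ r, D.settled ≤ ρ r → ρ r + 1 = k → ∃ m, scout.2.step (label r) (c.obs r) =
      (scout'.2, m) ∧ (P.traverse scout.1 m).1 = scout'.1)
    (hc : ∀ r, D.settled ≤ ρ r → ρ r + 1 ≠ k → ∃ m, (crew (ρ r)).step (label r) (c.obs r) =
      (crew' (ρ r), m) ∧ (P.traverse crewPos m).1 = crewPos')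
    (hw : ∀ r, ∀ f ∈ D.rest, ρ r = f.rank → (wait f).step (label r) (c.obs r) = (wait' f, none)) :
    D.Snap ρ host' scout' crewPos' crew' wait' (c.round P label) where
  host r hr := by
    obtain ⟨m, h1, h2⟩ := hh r hr
    rw [Swarm.round_pos, Swarm.round_st, Swarm.out, (S.host r hr).1, (S.host r hr).2, h1]
    exact ⟨h2, rfl⟩
  scout r hr hr' := by
    obtain ⟨m, h1, h2⟩ := hs r hr hr'
    rw [Swarm.round_pos, Swarm.round_st, Swarm.out, (S.scout r hr hr').1, (S.scout r hr hr').2, h1]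
    exact ⟨h2, rfl⟩
  crew r hr hr' := by
    obtain ⟨m, h1, h2⟩ := hc r hr hr'
    rw [Swarm.round_pos, Swarm.round_st, Swarm.out, (S.crew r hr hr').1, (S.crew r hr hr').2, h1]
    exact ⟨h2, rfl⟩
  wait r f hf hr := by
    rw [Swarm.round_pos, Swarm.round_st, Swarm.out, (S.wait r f hf hr).1, (S.wait r f hf hr).2,
      hw r f hf hr]
    exact ⟨rfl, rfl⟩
  done r hr hr' := by
    rw [Swarm.round_pos, Swarm.round_st, Swarm.out, (S.done r hr hr').1, (S.done r hr hr').2]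
    exact ⟨rfl, rfl⟩

omit [Fintype V] [DecidableEq V] in
/-- The settled robot of a finished node joins the idle robots. -/
theorem Search.Snap.pop {D : Search V} {g : Frame V} {l : List (Frame V)} (hD : D.rest = g :: l)
    (hcur : D.cur.node = D.home D.cur.rank)
    (S : D.Snap ρ (D.cur.node, .idle) scout crewPos crew wait c) :
    Search.Snap ⟨D.settled, D.home, g, l⟩ ρ (g.node, wait g) scout crewPos crew wait c where
  host r hr := S.wait r g (by simp [hD]) hr
  scout := S.scout
  crew := S.crew
  wait r f hf hr := S.wait r f (by simp [hD, hf]) hr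
  done r hr hr' := by
    by_cases h : ρ r = D.cur.rank
    · rw [h, ← hcur]
      exact S.host r h
    · refine S.done r hr fun f hf => ?_
      rw [path, hD] at hf
      rcases List.mem_cons.1 hf with rfl | hf
      · exact h
      · exact hr' f hf

end Snap

/-! ### The invariant of the depth-first search -/

section Inv

variable {V : Type*} [Fintype V] {G : SimpleGraph V} [DecidableRel G.Adj] (P : PortLabelling G)

/-- Advance to the next port of a node of degree `d`. -/
def Frame.advance (d : ℕ) (f : Frame V) : Frame V :=
  { f with rem := f.rem - 1, port := nextPort f.port d }

/-- Every neighbour of the node is occupied or reached through one of the remaining ports. -/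
structure Frame.Valid (occ : V → Prop) (f : Frame V) : Prop where
  port_lt : f.port < G.degree f.node
  rem_le : f.rem ≤ G.degree f.node
  examined : ∀ w, G.Adj f.node w → occ w ∨
    ∃ j < f.rem, (P.traverse f.node (some ((f.port + j) % G.degree f.node))).1 = w

/-- Consecutive nodes of a path are joined through the parent port of the first, which is the last
of its ports to be examined, and the port that precedes the next port of the second. -/
def Linked : List (Frame V) → Prop
  | [] => True
  | [f] => f.par = none
  | f :: g :: l => (∃ q x, f.par = some q ∧ q < G.degree f.node ∧
      P.traverse f.node (some q) = (g.node, some x) ∧ nextPort x (G.degree g.node) = g.port ∧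
      (f.port + f.rem) % G.degree f.node = q) ∧ Linked (g :: l)

def Search.occ (D : Search V) (v : V) : Prop := ∃ i < D.settled, D.home i = v

/-- The part of the invariant that does not involve the graph; it suffices for reasoning about
positions. -/
structure Search.Core (D : Search V) : Prop where
  home_inj : ∀ i < D.settled, ∀ j < D.settled, D.home i = D.home j → i = j
  nodup : (D.path.map Frame.rank).Nodup
  rank_lt : ∀ f ∈ D.path, f.rank < D.settled
  node_eq : ∀ f ∈ D.path, f.node = D.home f.rank

structure Search.Inv (D : Search V) : Prop extends D.Core where
  linked : Linked P D.path
  valid : ∀ f ∈ D.path, f.Valid P D.occ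
  finished : ∀ i < D.settled, (∀ f ∈ D.path, i ≠ f.rank) → ∀ w, G.Adj (D.home i) w → D.occ w

variable {P} {D : Search V}

theorem Frame.Valid.mono {occ occ' : V → Prop} (h : ∀ v, occ v → occ' v) {f : Frame V}
    (hf : f.Valid P occ) : f.Valid P occ' :=
  ⟨hf.port_lt, hf.rem_le, fun w hw => (hf.examined w hw).imp_left (h w)⟩

theorem nextPort_lt {p d : ℕ} (h : p < d) : nextPort p d < d := by
  rw [nextPort_eq_mod h]
  exact Nat.mod_lt _ (by omega)

theorem nextPort_add_mod {p d j : ℕ} (h : p < d) : (nextPort p d + j) % d = (p + (j + 1)) % d := by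
  rw [nextPort_eq_mod h, Nat.mod_add_mod]
  congr 1
  omega

/-- The remaining port at offset 0 is the one just examined, and it leads to an occupied node; the
other offsets shift by one. -/
theorem Frame.Valid.advance {occ : V → Prop} {f : Frame V} (hf : f.Valid P occ)
    (h : occ (P.traverse f.node (some f.port)).1) :
    (f.advance (G.degree f.node)).Valid P occ where
  port_lt := nextPort_lt hf.port_lt
  rem_le := (Nat.sub_le _ _).trans hf.rem_le
  examined w hw := by
    rcases hf.examined w hw with h1 | ⟨j, hj, h1⟩
    · exact Or.inl h1
    · cases j with
      | zero =>
        rw [Nat.add_zero, Nat.mod_eq_of_lt hf.port_lt] at h1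
        exact Or.inl (h1 ▸ h)
      | succ j =>
        exact Or.inr ⟨j, Nat.lt_sub_of_add_lt hj, (congrArg
          (fun p => (P.traverse f.node (some p)).1) (nextPort_add_mod hf.port_lt)).trans h1⟩

/-- The sum `port + rem` does not change modulo the degree, so the parent port stays last in the
cyclic order. With `rem = 0` the truncated subtraction would break this. -/
theorem Linked.advance {f : Frame V} {l : List (Frame V)} (h : Linked P (f :: l))
    (hp : f.port < G.degree f.node) (hr : f.rem ≠ 0) :
    Linked P (f.advance (G.degree f.node) :: l) := by
  cases l with
  | nil => exact h
  | cons g l =>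
    obtain ⟨⟨q, x, h1, h2, h3, h4, h5⟩, h6⟩ := h
    have h7 : f.rem - 1 + 1 = f.rem := Nat.sub_add_cancel (Nat.one_le_iff_ne_zero.2 hr)
    exact ⟨⟨q, x, h1, h2, h3, h4, (nextPort_add_mod hp).trans
      ((congrArg (fun m => (f.port + m) % G.degree f.node) h7).trans h5)⟩, h6⟩

/-- The examined ports of a node lead to different occupied nodes. -/
theorem Search.Inv.degree_le (h : D.Inv P) {f : Frame V} (hf : f ∈ D.path) :
    G.degree f.node ≤ D.settled + f.rem := by
  classical
  have h1 : G.neighborFinset f.node ⊆ (Finset.range D.settled).image D.home ∪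
      (Finset.range f.rem).image fun j =>
        (P.traverse f.node (some ((f.port + j) % G.degree f.node))).1 := by
    intro w hw
    rw [SimpleGraph.mem_neighborFinset] at hw
    simpa [Search.occ] using (h.valid f hf).examined w hw
  rw [← SimpleGraph.card_neighborFinset_eq_degree]
  refine (Finset.card_le_card h1).trans ((Finset.card_union_le _ _).trans
    (add_le_add (Finset.card_image_le.trans ?_) (Finset.card_image_le.trans ?_))) <;> simp

/-- A bound for the number of periods that remain. -/
def Search.remaining (G : SimpleGraph V) [DecidableRel G.Adj] (k : ℕ) (D : Search V) : ℕ :=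
  (k - D.settled) * (k + 2) + (D.path.map fun f => k + 1 - (G.degree f.node - f.rem)).sum

/-- The next port of the current node leads to an occupied node. -/
def Search.advance (G : SimpleGraph V) [DecidableRel G.Adj] (D : Search V) : Search V :=
  { D with cur := D.cur.advance (G.degree D.cur.node) }

theorem Search.Inv.advance (h : D.Inv P) (hr : D.cur.rem ≠ 0)
    (ho : D.occ (P.traverse D.cur.node (some D.cur.port)).1) : (D.advance G).Inv P := by
  have hmem : D.cur ∈ D.path := by simp [path]
  have hv := h.valid _ hmem
  have hp : ∀ p : Frame V → Prop, (p D.cur → p (D.cur.advance (G.degree D.cur.node))) →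
      (∀ f ∈ D.path, p f) → ∀ f ∈ (D.advance G).path, p f := by
    intro p h1 h2
    simp only [path, Search.advance, List.mem_cons, forall_eq_or_imp] at h2 ⊢
    exact ⟨h1 h2.1, h2.2⟩
  exact
  { home_inj := h.home_inj
    nodup := h.nodup
    rank_lt := hp _ id h.rank_lt
    node_eq := hp _ id h.node_eq
    linked := Linked.advance h.linked hv.port_lt hr
    valid := hp _ (fun _ => hv.advance ho) h.valid
    finished := fun i hi hi' => h.finished i hi (by
      simp only [path, Search.advance, List.mem_cons, forall_eq_or_imp] at hi' ⊢
      exact hi') }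

/-- One more port counts as examined. The bound by `k` keeps the truncated difference positive
beforehand, so it does decrease. -/
theorem Frame.advance_remaining {k : ℕ} {f : Frame V} (hr : f.rem ≠ 0)
    (h : G.degree f.node ≤ k + f.rem) (h' : f.rem ≤ G.degree f.node) :
    k + 1 - (G.degree (f.advance (G.degree f.node)).node - (f.advance (G.degree f.node)).rem) <
      k + 1 - (G.degree f.node - f.rem) := by
  change k + 1 - (G.degree f.node - (f.rem - 1)) < _
  omega

theorem Search.Inv.advance_remaining {k : ℕ} (h : D.Inv P) (hk : D.settled ≤ k)
    (hr : D.cur.rem ≠ 0) : (D.advance G).remaining G k < D.remaining G k := by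
  have hmem : D.cur ∈ D.path := by simp [path]
  have h1 := h.degree_le hmem
  have h2 := Frame.advance_remaining (k := k) hr (by omega) (h.valid _ hmem).rem_le
  simp only [remaining, path, Search.advance, List.map_cons, List.sum_cons]
  exact Nat.add_lt_add_left (Nat.add_lt_add_right h2 _) _

/-- The next port of the current node leads to an unoccupied node `w`, which is entered through its
port `x`. -/
def Search.push (G : SimpleGraph V) [DecidableRel G.Adj] (D : Search V) (w : V) (x : ℕ) :
    Search V where
  settled := D.settled + 1
  home := Function.update D.home D.settled w
  cur := ⟨D.settled, w, G.degree w - 1, some x, nextPort x (G.degree w)⟩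
  rest := D.cur.advance (G.degree D.cur.node) :: D.rest

theorem Search.Core.push (h : D.Core) {w : V} {x : ℕ} (hw : ¬ D.occ w) : (D.push G w x).Core := by
  have hhome : ∀ i < D.settled, (D.push G w x).home i = D.home i := fun i hi => by
    simp [Search.push, Function.update_of_ne hi.ne]
  have hn : (D.push G w x).home D.settled = w := by simp [Search.push]
  have hp : ∀ p : Frame V → Prop, p (D.push G w x).cur →
      (p D.cur → p (D.cur.advance (G.degree D.cur.node))) →
      (∀ f ∈ D.path, p f) → ∀ f ∈ (D.push G w x).path, p f := by
    intro p h0 h1 h2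
    simp only [path, Search.push, List.mem_cons, forall_eq_or_imp] at h2 ⊢
    exact ⟨h0, h1 h2.1, h2.2⟩
  have hr : ∀ f ∈ D.path, f.rank < D.settled + 1 := fun f hf => (h.rank_lt f hf).trans_le (by omega)
  refine ⟨fun i hi j hj hij => ?_, ?_, hp _ (Nat.lt_succ_self _) id hr,
    hp _ hn.symm id fun f hf => ?_⟩
  · have h1 : ∀ i < D.settled, D.home i ≠ w := fun i hi e => hw ⟨i, hi, e⟩
    simp only [Search.push] at hi hj
    rcases Nat.lt_succ_iff_lt_or_eq.1 hi with hi | rfl <;>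
      rcases Nat.lt_succ_iff_lt_or_eq.1 hj with hj | rfl
    · rw [hhome i hi, hhome j hj] at hij
      exact h.home_inj i hi j hj hij
    · rw [hhome i hi, hn] at hij
      exact absurd hij (h1 i hi)
    · rw [hhome j hj, hn] at hij
      exact absurd hij.symm (h1 j hj)
    · rfl
  · have h1 := h.nodup
    simp only [path, Search.push, List.map_cons, Frame.advance] at h1 ⊢
    refine List.nodup_cons.2 ⟨fun hmem => ?_, h1⟩
    rw [← List.map_cons, List.mem_map] at hmem
    obtain ⟨f, hf, hf'⟩ := hmem
    have := h.rank_lt f hf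
    omega
  · rw [hhome _ (h.rank_lt f hf)]
    exact h.node_eq f hf

/-- Starting after `x` with `G.degree w - 1` ports to go covers every port but `x`, and `x` leads
back to the occupied current node. The port that would come next is `x`, which gives the link. -/
theorem Search.Inv.push (h : D.Inv P) (hr : D.cur.rem ≠ 0) {w : V} {x : ℕ} (hw : ¬ D.occ w)
    (hvw : P.traverse D.cur.node (some D.cur.port) = (w, some x)) (hx : x < G.degree w)
    (hwv : P.traverse w (some x) = (D.cur.node, some D.cur.port)) : (D.push G w x).Inv P := by
  have hmem : D.cur ∈ D.path := by simp [path]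
  have hv := h.valid _ hmem
  have hhome : ∀ i < D.settled, (D.push G w x).home i = D.home i := fun i hi => by
    simp [Search.push, Function.update_of_ne hi.ne]
  have hocc : ∀ v, D.occ v → (D.push G w x).occ v := fun v ⟨i, hi, hiv⟩ =>
    ⟨i, hi.trans (Nat.lt_succ_self _), by rw [hhome i hi, hiv]⟩
  have hn : (D.push G w x).home D.settled = w := by simp [Search.push]
  have hd : (nextPort x (G.degree w) + (G.degree w - 1)) % G.degree w = x := by
    rw [nextPort_add_mod hx, Nat.sub_add_cancel (by omega), Nat.add_mod_right, Nat.mod_eq_of_lt hx]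
  refine { h.toCore.push hw with linked := ?_, valid := ?_, finished := ?_ }
  · exact ⟨⟨x, D.cur.port, rfl, hx, hwv, rfl, hd⟩, Linked.advance h.linked hv.port_lt hr⟩
  · simp only [path, Search.push, List.mem_cons, forall_eq_or_imp]
    refine ⟨⟨nextPort_lt hx, Nat.sub_le _ _, fun u hu => ?_⟩, (hv.mono hocc).advance ?_,
      fun f hf => (h.valid f (by simp [path, hf])).mono hocc⟩
    · obtain ⟨p, hp, rfl⟩ := P.exists_port hu
      simp only at hp hu ⊢
      by_cases hpx : p = x
      · rw [hpx, hwv]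
        exact Or.inl (hocc _ ⟨_, h.rank_lt _ hmem, (h.node_eq _ hmem).symm⟩)
      · right
        -- The offset of `p` from the successor of `x` in cyclic order is `p - x - 1`, with the
        -- degree added when `p` precedes `x`.
        by_cases hlt : x < p
        · refine ⟨p - x - 1, by omega, ?_⟩
          rw [nextPort_add_mod hx, show x + (p - x - 1 + 1) = p by omega, Nat.mod_eq_of_lt hp]
        · refine ⟨p + G.degree w - x - 1, by omega, ?_⟩
          rw [nextPort_add_mod hx, show x + (p + G.degree w - x - 1 + 1) = p + G.degree w by omega,
            Nat.add_mod_right, Nat.mod_eq_of_lt hp]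
    · rw [hvw]
      exact ⟨D.settled, Nat.lt_succ_self _, hn⟩
  · intro i hi hi' u hu
    simp only [path, Search.push, List.mem_cons, forall_eq_or_imp] at hi hi'
    have hi2 : i < D.settled := by omega
    rw [hhome i hi2] at hu
    refine hocc u (h.finished i hi2 ?_ u hu)
    simp only [path, List.mem_cons, forall_eq_or_imp]
    exact hi'.2

/-- Settling one more robot releases `k + 2`, while the new frame contributes at most `k + 1`; the
advance of the old frame only helps. -/
theorem Search.Inv.push_remaining {k : ℕ} (h : D.Inv P) (hk : D.settled < k) (hr : D.cur.rem ≠ 0)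
    (w : V) (x : ℕ) : (D.push G w x).remaining G k < D.remaining G k := by
  have hmem : D.cur ∈ D.path := by simp [path]
  have h1 := h.degree_le hmem
  have h2 := Frame.advance_remaining (k := k) hr (by omega) (h.valid _ hmem).rem_le
  obtain ⟨e, rfl⟩ : ∃ e, k = D.settled + 1 + e := ⟨k - (D.settled + 1), by omega⟩
  simp only [remaining, path, Search.push, List.map_cons, List.sum_cons]
  rw [show D.settled + 1 + e - (D.settled + 1) = e by omega,
    show D.settled + 1 + e - D.settled = e + 1 by omega, Nat.add_mul]
  omega

omit [Fintype V] in
theorem Search.Core.pop (h : D.Core) {g : Frame V} {l : List (Frame V)} (hD : D.rest = g :: l) :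
    Search.Core ⟨D.settled, D.home, g, l⟩ := by
  have hp : ∀ f ∈ g :: l, f ∈ D.path := fun f hf => by
    rw [path, hD]
    exact List.mem_cons_of_mem _ hf
  refine ⟨h.home_inj, ?_, fun f hf => h.rank_lt f (hp f hf), fun f hf => h.node_eq f (hp f hf)⟩
  have h1 := h.nodup
  rw [path, hD, List.map_cons] at h1
  exact h1.of_cons

/-- With no port remaining, `examined` says that all neighbours are occupied, which is what
`finished` requires of a node that leaves the path. -/
theorem Search.Inv.pop (h : D.Inv P) (hr : D.cur.rem = 0) {g : Frame V} {l : List (Frame V)}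
    (hD : D.rest = g :: l) : Search.Inv P ⟨D.settled, D.home, g, l⟩ := by
  have hmem : D.cur ∈ D.path := by simp [path]
  have hp : ∀ f ∈ g :: l, f ∈ D.path := fun f hf => by
    rw [path, hD]
    exact List.mem_cons_of_mem _ hf
  have hl := h.linked
  rw [path, hD] at hl
  refine { h.toCore.pop hD with
    linked := hl.2, valid := fun f hf => h.valid f (hp f hf), finished := ?_ }
  intro i hi hi' w hw
  by_cases hc : i = D.cur.rank
  · simp only at hw
    rw [hc, ← h.node_eq _ hmem] at hw
    simpa [hr, occ] using (h.valid _ hmem).examined w hw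
  · refine h.finished i hi (fun f hf => ?_) w hw
    rw [path, hD] at hf
    rcases List.mem_cons.1 hf with rfl | hf
    · exact hc
    · exact hi' f hf

/-- The removed frame had a positive contribution, because `Search.Inv.degree_le` bounds its
examined ports by `k`. -/
theorem Search.Inv.pop_remaining {k : ℕ} (h : D.Inv P) (hk : D.settled ≤ k) {g : Frame V}
    {l : List (Frame V)} (hD : D.rest = g :: l) :
    Search.remaining G k ⟨D.settled, D.home, g, l⟩ < D.remaining G k := by
  have hmem : D.cur ∈ D.path := by simp [path]
  have h1 := h.degree_le hmem
  simp only [remaining, path, hD, List.map_cons, List.sum_cons]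
  omega

/-- The search does not return to the source before all nodes are occupied. -/
theorem Search.Inv.rest_ne_nil (h : D.Inv P) (hG : G.Connected) (hn : D.settled < Fintype.card V)
    (hr : D.cur.rem = 0) : D.rest ≠ [] := by
  classical
  intro hD
  have hmem : D.cur ∈ D.path := by simp [path]
  -- The occupied set is closed under adjacency: nodes off the path are finished, and the only node
  -- on it has no port left.
  have hstep : ∀ v w, G.Adj v w → D.occ v → D.occ w := by
    rintro _ w hw ⟨i, hi, rfl⟩
    by_cases hc : i = D.cur.rank
    · rw [hc, ← h.node_eq _ hmem] at hw
      simpa [hr] using (h.valid _ hmem).examined w hw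
    · exact h.finished i hi (by simpa [path, hD] using hc) w hw
  have hall : ∀ v, D.occ v := fun v => by
    obtain ⟨p⟩ := hG.preconnected D.cur.node v
    have h0 : D.occ D.cur.node := ⟨_, h.rank_lt _ hmem, (h.node_eq _ hmem).symm⟩
    clear hr hD hn h hmem
    generalize D.cur.node = u at p h0
    induction p with
    | nil => exact h0
    | cons hadj _ ih => exact ih (hstep _ _ hadj h0)
  have h2 : (Finset.univ : Finset V) ⊆ (Finset.range D.settled).image D.home := fun v _ => by
    simpa [occ] using hall v
  have h3 := (Finset.card_le_card h2).trans Finset.card_image_le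
  rw [Finset.card_univ, Finset.card_range] at h3
  omega

end Inv

/-! ### The periods of the depth-first search -/

section Periods

variable {V : Type*} [Fintype V] [DecidableEq V] {G : SimpleGraph V} [DecidableRel G.Adj]
  {P : PortLabelling G} {k : ℕ} {label ρ : Fin k → ℕ} {D : Search V} {c : Swarm V k}

/-- The data of the unsettled robot of rank `i`. -/
def Search.pack (G : SimpleGraph V) [DecidableRel G.Adj] (D : Search V) (b : Bool) (i : ℕ) :
    Traveller :=
  ⟨b, i, D.settled, D.cur.port, G.degree D.cur.node⟩

/-- The swarm performs the search `D`, and a period begins. -/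
def Search.Sim (G : SimpleGraph V) [DecidableRel G.Adj] (ρ : Fin k → ℕ) (D : Search V)
    (c : Swarm V k) : Prop :=
  D.Snap ρ (D.cur.node, .host .signal D.cur.rem D.cur.par)
    (D.cur.node, .member .signal .scan (D.pack G true (k - 1))) D.cur.node
    (fun i => .member .signal .scan (D.pack G false i)) (fun f => .waiting .signal f.rem f.par) c

omit [Fintype V] [DecidableEq V] in
theorem Search.Core.cur_node (h : D.Core) : D.cur.node = D.home D.cur.rank :=
  h.node_eq _ (by simp [path])

omit [Fintype V] [DecidableEq V] in
theorem Search.Core.occ_node (h : D.Core) {f : Frame V} (hf : f ∈ D.path) : D.occ f.node :=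
  ⟨_, h.rank_lt f hf, (h.node_eq f hf).symm⟩

omit [Fintype V] [DecidableEq V] in
theorem Search.Core.rank_ne (h : D.Core) {f : Frame V} (hf : f ∈ D.rest) :
    f.rank ≠ D.cur.rank := by
  have h1 := h.nodup
  simp only [path, List.map_cons, List.nodup_cons] at h1
  exact fun e => h1.1 (e ▸ List.mem_map_of_mem hf)

omit [Fintype V] [DecidableEq V] in
theorem Search.Core.node_ne (h : D.Core) {f : Frame V} (hf : f ∈ D.rest) :
    f.node ≠ D.cur.node := by
  intro e
  have hf' : f ∈ D.path := List.mem_cons_of_mem _ hf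
  rw [h.cur_node, h.node_eq f hf'] at e
  exact h.rank_ne hf (h.home_inj _ (h.rank_lt f hf') _ (h.rank_lt _ (by simp [path])) e)

variable {host scout : V × State} {crewPos : V} {crew : ℕ → State} {wait : Frame V → State}

omit [Fintype V] [DecidableEq V] in
-- The hypothesis `hh` excludes the moments when the settled robot of the current node is away to
-- signal or to notify.
theorem Search.Snap.settled_pos (S : D.Snap ρ host scout crewPos crew wait c) (h : D.Core)
    (hh : host.1 = D.cur.node) {r : Fin k} (hr : ρ r < D.settled) : c.pos r = D.home (ρ r) := by
  rcases D.cases k (ρ r) with h1 | ⟨h1, -⟩ | ⟨h1, -⟩ | ⟨f, hf, h1⟩ | ⟨h1, h2⟩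
  · rw [(S.host r h1).1, hh, h.cur_node, h1]
  · omega
  · omega
  · rw [(S.wait r f hf h1).1, h.node_eq f (List.mem_cons_of_mem _ hf), h1]
  · exact (S.done r h1 h2).1

omit [DecidableEq V] in
theorem Search.Snap.advance (S : D.Snap ρ host scout crewPos crew wait c) :
    (D.advance G).Snap ρ host scout crewPos crew wait c :=
  ⟨S.host, S.scout, S.crew, S.wait, fun r hr hr' => S.done r hr (by
    simp only [path, Search.advance, List.mem_cons, forall_eq_or_imp] at hr' ⊢
    exact hr')⟩

omit [DecidableEq V] in
-- The old settled robot must already be in the waiting state of the advanced frame, so that it can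
-- join the ancestors; the robot of rank `D.settled` takes over its role.
theorem Search.Snap.push {host' scout' : V × State} {crewPos' : V} {crew' : ℕ → State} {w : V}
    {x : ℕ} (S : D.Snap ρ (D.cur.node, wait (D.cur.advance (G.degree D.cur.node))) scout crewPos
      crew wait c)
    (hh : ∀ r, ρ r = D.settled → c.pos r = host'.1 ∧ c.st r = host'.2)
    (hs : ∀ r, D.settled + 1 ≤ ρ r → ρ r + 1 = k → c.pos r = scout'.1 ∧ c.st r = scout'.2)
    (hc : ∀ r, D.settled + 1 ≤ ρ r → ρ r + 1 ≠ k → c.pos r = crewPos' ∧ c.st r = crew' (ρ r)) :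
    (D.push G w x).Snap ρ host' scout' crewPos' crew' wait c where
  host := hh
  scout := hs
  crew := hc
  wait r f hf hr := by
    rcases List.mem_cons.1 hf with rfl | hf
    · exact S.host r hr
    · exact S.wait r f hf hr
  done r hr hr' := by
    simp only [path, Search.push, List.mem_cons, forall_eq_or_imp] at hr hr'
    have h1 : ρ r < D.settled := by omega
    have h2 := S.done r h1 (by
      simp only [path, List.mem_cons, forall_eq_or_imp]
      exact hr'.2)
    simpa [Search.push, Function.update_of_ne h1.ne] using h2

/-- The first two rounds of a period in which the scout leaves. -/
theorem Search.Sim.explore (hρ : Function.Injective ρ) (hρs : ∀ i < k, ∃ r, ρ r = i)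
    (hn : D.settled < k) (S : D.Sim G ρ c) (h : D.Core) (hr : D.cur.rem ≠ 0) {w : V} {x : ℕ}
    (hvw : P.traverse D.cur.node (some D.cur.port) = (w, some x)) (hne : D.cur.node ≠ w) :
    D.Snap ρ (D.cur.node, .host .report D.cur.rem D.cur.par)
      (w, .member .report .scan (D.pack G true (k - 1))) D.cur.node
      (fun i => .member .report .scan (D.pack G false i)) (fun f => .waiting .report f.rem f.par)
      ((c.round P label).round P label) ∧
    ∀ r, D.settled ≤ ρ r → ρ r + 1 = k →
      (((c.round P label).round P label).obs r).inPort = some x ∧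
      (((c.round P label).round P label).obs r).degree = some (G.degree w) ∧
      ((((c.round P label).round P label).obs r).alone = true ↔ ¬ D.occ w) := by
  have S1 := S.round (P := P) (label := label) (D.cur.node, .host .scout D.cur.rem D.cur.par)
    (D.cur.node, .member .scout .scan (D.pack G true (k - 1))) D.cur.node
    (fun i => .member .scout .scan (D.pack G false i)) (fun f => .waiting .scout f.rem f.par)
    (fun r _ => ⟨none, by simp [State.step, hr], rfl⟩) (fun r _ _ => ⟨none, rfl, rfl⟩)
    (fun r _ _ => ⟨none, rfl, rfl⟩) (fun r f _ _ => rfl)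
  have hdec : ∀ r, ((c.round P label).obs r).decrease = false := fun r =>
    Swarm.not_decrease (occupancy_le (Snap.mono S S1 id id id))
  have hin : ∀ r, ρ r = D.cur.rank → ((c.round P label).obs r).inPort = none := fun r h1 => by
    rw [Swarm.round_inPort, Swarm.out, (S.host r h1).2]
    simp [State.step, hr]
  have S2 := S1.round (P := P) (label := label) (D.cur.node, .host .report D.cur.rem D.cur.par)
    (w, .member .report .scan (D.pack G true (k - 1))) D.cur.node
    (fun i => .member .report .scan (D.pack G false i)) (fun f => .waiting .report f.rem f.par)
    (fun r h1 => ⟨none, by simp [State.step, hin r h1], rfl⟩)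
    (fun r _ _ => ⟨some D.cur.port, by simp [State.step, hdec, pack], by simp [hvw]⟩)
    (fun r _ _ => ⟨none, by simp [State.step, hdec, pack], rfl⟩) (fun r f _ _ => rfl)
  refine ⟨S2, fun r h1 h2 => ?_⟩
  have hi : (((c.round P label).round P label).obs r).inPort = some x := by
    rw [Swarm.round_inPort, Swarm.out, (S1.scout r h1 h2).1, (S1.scout r h1 h2).2]
    simp [State.step, hdec, pack, hvw]
  refine ⟨hi, ?_, ?_⟩
  · rw [Swarm.round_degree hi, (S2.scout r h1 h2).1]
  -- Settled robots are at their homes and the rest of the group is at the current node, which is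
  -- not `w`; so the scout's only possible company is a settled robot.
  · rw [Swarm.round_alone, occupancy_eq_one_iff r rfl, (S2.scout r h1 h2).1]
    constructor
    · rintro h3 ⟨i, hi, rfl⟩
      obtain ⟨r', rfl⟩ := hρs i (hi.trans hn)
      have := h3 r' (S2.settled_pos h rfl hi)
      rw [this] at hi
      omega
    · intro h3 r' h4
      rcases Nat.lt_or_ge (ρ r') D.settled with h5 | h5
      · rw [S2.settled_pos h rfl h5] at h4
        exact absurd ⟨_, h5, h4⟩ h3
      · by_cases h6 : ρ r' + 1 = k
        · exact hρ (by omega)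
        · rw [(S2.crew r' h5 h6).1] at h4
          exact absurd h4 hne

/-- A period in which the scout finds an occupied node. -/
theorem Search.Sim.scan (hρ : Function.Injective ρ) (hρs : ∀ i < k, ∃ r, ρ r = i)
    (hn : D.settled < k) (S : D.Sim G ρ c) (h : D.Core) (hr : D.cur.rem ≠ 0) {w : V} {x : ℕ}
    (hvw : P.traverse D.cur.node (some D.cur.port) = (w, some x))
    (hwv : P.traverse w (some x) = (D.cur.node, some D.cur.port)) (hne : D.cur.node ≠ w)
    (hw : D.occ w) : (D.advance G).Sim G ρ ((Swarm.round P label)^[5] c) := by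
  obtain ⟨S2, ho⟩ := Search.Sim.explore (label := label) hρ hρs hn S h hr hvw hne
  obtain ⟨r₀, hr₀⟩ := hρs (k - 1) (by omega)
  change (D.advance G).Sim G ρ ((((c.round P label).round P label).round P label).round P label
    |>.round P label)
  generalize (c.round P label).round P label = c2 at *
  have S3 := S2.round (P := P) (label := label) (D.cur.node, .host .move D.cur.rem D.cur.par)
    (D.cur.node, .member .move .scan (D.pack G true (k - 1))) D.cur.node
    (fun i => .member .move .scan (D.pack G false i)) (fun f => .waiting .move f.rem f.par)
    (fun r _ => ⟨none, rfl, rfl⟩)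
    (fun r h1 h2 => by
      obtain ⟨h3, h4, h5⟩ := ho r h1 h2
      have h6 : (c2.obs r).alone = false := by
        rw [← Bool.not_eq_true, h5, not_not]
        exact hw
      exact ⟨some x, by simp [State.step, h6, pack, h3], by simp [hwv]⟩)
    (fun r _ _ => ⟨none, by simp [State.step, pack], rfl⟩) (fun r f _ _ => rfl)
  have hlt : occupancy c2.pos D.cur.node < occupancy (c2.round P label).pos D.cur.node := by
    refine occupancy_lt (Snap.mono S2 S3 id (fun e => absurd e.symm hne) id) r₀ ?_ ?_
    · rw [(S2.scout r₀ (by omega) (by omega)).1]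
      exact hne.symm
    · rw [(S3.scout r₀ (by omega) (by omega)).1]
  have hinc : ∀ r, (c2.out label r).2 = none → c2.pos r = D.cur.node →
      ((c2.round P label).obs r).increase = true := fun r h1 h2 => by
    rw [Swarm.round_increase h1, h2]
    exact hlt
  -- The scout's return affects only the current node, so no ancestor mistakes it for a
  -- notification.
  have hwait : ∀ r, ∀ f ∈ D.rest, ρ r = f.rank → ((c2.round P label).obs r).increase = false :=
    fun r f hf h1 => Swarm.not_increase (by
      rw [(S3.wait r f hf h1).1]
      exact occupancy_le (Snap.mono S3 S2 id (fun e => absurd e.symm (h.node_ne hf)) id))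
  have S4 := S3.round (P := P) (label := label)
    (D.cur.node, .host .arrive (D.cur.rem - 1) D.cur.par)
    (D.cur.node, .member .arrive .scan ((D.advance G).pack G true (k - 1))) D.cur.node
    (fun i => .member .arrive .scan ((D.advance G).pack G false i))
    (fun f => .waiting .arrive f.rem f.par)
    (fun r h1 => ⟨none, by
      simp [State.step, hr, hinc r (by simp [Swarm.out, (S2.host r h1).2, State.step])
        (S2.host r h1).1], rfl⟩)
    (fun r _ _ => ⟨none, rfl, rfl⟩)
    (fun r h1 h2 => ⟨none, by
      have := hinc r (by simp [Swarm.out, (S2.crew r h1 h2).2, State.step, pack])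
        (S2.crew r h1 h2).1
      simp only [State.step, this, Bool.or_true, if_true]
      rfl, rfl⟩)
    (fun r f hf h1 => by simp [State.step, hwait r f hf h1])
  have hno : ∀ r, (((c2.round P label).round P label).obs r).increase = false := fun r =>
    Swarm.not_increase (occupancy_le (Snap.mono S4 S3 id id id))
  exact (S4.round (P := P) (label := label)
    (D.cur.node, .host .signal (D.cur.rem - 1) D.cur.par)
    (D.cur.node, .member .signal .scan ((D.advance G).pack G true (k - 1))) D.cur.node
    (fun i => .member .signal .scan ((D.advance G).pack G false i))
    (fun f => .waiting .signal f.rem f.par)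
    (fun r _ => ⟨none, rfl, rfl⟩) (fun r _ _ => ⟨none, rfl, rfl⟩) (fun r _ _ => ⟨none, rfl, rfl⟩)
    (fun r f _ _ => by simp [State.step, hno])).advance

/-- A period in which a node is discovered, but robots other than the scout remain. -/
theorem Search.Sim.discover (hρ : Function.Injective ρ) (hρs : ∀ i < k, ∃ r, ρ r = i)
    (hn : D.settled + 1 < k) (S : D.Sim G ρ c) (h : D.Core) (hr : D.cur.rem ≠ 0) {w : V} {x : ℕ}
    (hvw : P.traverse D.cur.node (some D.cur.port) = (w, some x)) (hne : D.cur.node ≠ w)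
    (hw : ¬ D.occ w) : (D.push G w x).Sim G ρ ((Swarm.round P label)^[5] c) := by
  obtain ⟨S2, ho⟩ := Search.Sim.explore (label := label) hρ hρs (by omega) S h hr hvw hne
  change (D.push G w x).Sim G ρ ((((c.round P label).round P label).round P label).round P label
    |>.round P label)
  generalize (c.round P label).round P label = c2 at *
  have S3 := S2.round (P := P) (label := label) (D.cur.node, .host .move D.cur.rem D.cur.par)
    (w, .member .move .fresh ((D.push G w x).pack G true (k - 1))) D.cur.node
    (fun i => .member .move .scan (D.pack G false i)) (fun f => .waiting .move f.rem f.par)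
    (fun r _ => ⟨none, rfl, rfl⟩)
    (fun r h1 h2 => by
      obtain ⟨h3, h4, h5⟩ := ho r h1 h2
      have h6 : (c2.obs r).alone = true := h5.2 hw
      have h7 : ¬ k - 1 ≤ D.settled := by omega
      refine ⟨none, ?_, rfl⟩
      simp only [State.step, pack, if_true, h6, if_neg h7, h3, h4]
      rfl)
    (fun r _ _ => ⟨none, by simp [State.step, pack], rfl⟩) (fun r f _ _ => rfl)
  -- The scout stays at `w`; the missing increase is what sends the others after it.
  have hno : ∀ r, ((c2.round P label).obs r).increase = false := fun r =>
    Swarm.not_increase (occupancy_le (Snap.mono S3 S2 id id id))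
  have S4 := S3.round (P := P) (label := label)
    (D.cur.node, .waiting .arrive (D.cur.rem - 1) D.cur.par)
    (w, .member .arrive .scan ((D.push G w x).pack G true (k - 1))) w
    (fun i => .member .arrive .fresh (D.pack G false i))
    (fun f => .waiting .arrive f.rem f.par)
    (fun r _ => ⟨none, by simp [State.step, hr, hno], rfl⟩)
    (fun r _ _ => ⟨none, rfl, rfl⟩)
    (fun r _ _ => ⟨some D.cur.port, by simp [State.step, hno, pack], by simp [hvw]⟩)
    (fun r f _ _ => by simp [State.step, hno])
  have hin : ∀ r, D.settled ≤ ρ r → ρ r + 1 ≠ k →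
      (((c2.round P label).round P label).obs r).inPort = some x ∧
      (((c2.round P label).round P label).obs r).degree = some (G.degree w) := fun r h1 h2 => by
    have h3 : (((c2.round P label).round P label).obs r).inPort = some x := by
      rw [Swarm.round_inPort, Swarm.out, (S3.crew r h1 h2).1, (S3.crew r h1 h2).2]
      simp [State.step, hno, pack, hvw]
    exact ⟨h3, by rw [Swarm.round_degree h3, (S4.crew r h1 h2).1]⟩
  -- The group arrives at `w`, which is not on the path, so no ancestor takes the arrival for a
  -- retreat.
  have hno' : ∀ f ∈ D.path, ∀ r, ((c2.round P label).round P label).pos r = f.node →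
      (((c2.round P label).round P label).obs r).increase = false := fun f hf r h1 =>
    Swarm.not_increase (by
      rw [h1]
      exact occupancy_le (Snap.mono S4 S3 id id
        (fun e => absurd (h.occ_node hf) (by rw [← e]; exact hw))))
  have S5 := S4.round (P := P) (label := label)
    (D.cur.node, .waiting .signal (D.cur.rem - 1) D.cur.par)
    (w, .member .signal .scan ((D.push G w x).pack G true (k - 1))) w
    -- Group members have rank at least `D.settled`, so exactly the one of rank `D.settled` settles.
    (fun i => if i ≤ D.settled then .host .signal (G.degree w - 1) (some x) else
      .member .signal .scan ((D.push G w x).pack G false i))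
    (fun f => .waiting .signal f.rem f.par)
    (fun r h1 => ⟨none, by
      simp [State.step, hno' D.cur (by simp [path]) r (S4.host r h1).1], rfl⟩)
    (fun r _ _ => ⟨none, rfl, rfl⟩)
    (fun r h1 h2 => ⟨none, by
      obtain ⟨h3, h4⟩ := hin r h1 h2
      simp only [State.step, pack, h3, h4]
      rfl, rfl⟩)
    (fun r f hf h1 => by
      simp [State.step, hno' f (List.mem_cons_of_mem _ hf) r (S4.wait r f hf h1).1])
  refine S5.push (fun r h1 => ?_) (fun r h1 => S5.scout r (by omega)) fun r h1 h2 => ?_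
  · obtain ⟨h2, h3⟩ := S5.crew r h1.ge (by omega)
    rw [if_pos h1.le] at h3
    exact ⟨h2, h3⟩
  · obtain ⟨h3, h4⟩ := S5.crew r (by omega) h2
    rw [if_neg (by omega)] at h4
    exact ⟨h3, h4⟩

/-- The last robot has settled or is being relieved: the settled robot of the current node is about
to notify that of its parent. -/
def Search.Notify (ρ : Fin k → ℕ) (D : Search V) (q : ℕ) (c : Swarm V k) : Prop :=
  D.Snap ρ (D.cur.node, .notifier .signal q) (D.cur.node, .idle) D.cur.node (fun _ => .idle)
    (fun f => .waiting .signal f.rem f.par) c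

/-- A period in which the last robot settles. -/
theorem Search.Sim.finish (hρ : Function.Injective ρ) (hρk : ∀ r, ρ r < k)
    (hρs : ∀ i < k, ∃ r, ρ r = i)
    (hn : D.settled + 1 = k) (S : D.Sim G ρ c) (h : D.Core) (hr : D.cur.rem ≠ 0) {w : V} {x : ℕ}
    (hvw : P.traverse D.cur.node (some D.cur.port) = (w, some x)) (hne : D.cur.node ≠ w)
    (hw : ¬ D.occ w) : (D.push G w x).Notify ρ x ((Swarm.round P label)^[5] c) := by
  obtain ⟨S2, ho⟩ := Search.Sim.explore (label := label) hρ hρs (by omega) S h hr hvw hne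
  change (D.push G w x).Notify ρ x ((((c.round P label).round P label).round P label).round P label
    |>.round P label)
  generalize (c.round P label).round P label = c2 at *
  -- The scout is the only unsettled robot, so the clauses for the rest of the group are vacuous.
  have hvac : ∀ r, D.settled ≤ ρ r → ρ r + 1 ≠ k → False := fun r h1 h2 => by
    have := hρk r
    omega
  have S3 := S2.round (P := P) (label := label) (D.cur.node, .host .move D.cur.rem D.cur.par)
    (w, .notifier .move x) D.cur.node (fun _ => .idle) (fun f => .waiting .move f.rem f.par)
    (fun r _ => ⟨none, rfl, rfl⟩)
    (fun r h1 h2 => by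
      obtain ⟨h3, h4, h5⟩ := ho r h1 h2
      have h6 : (c2.obs r).alone = true := h5.2 hw
      have h7 : k - 1 ≤ D.settled := by omega
      refine ⟨none, ?_, rfl⟩
      simp only [State.step, pack, if_true, h6, if_pos h7, h3]
      rfl)
    (fun r h1 h2 => (hvac r h1 h2).elim) (fun r f _ _ => rfl)
  have hno : ∀ r, ((c2.round P label).obs r).increase = false := fun r =>
    Swarm.not_increase (occupancy_le (Snap.mono S3 S2 id id id))
  have S4 := S3.round (P := P) (label := label)
    (D.cur.node, .waiting .arrive (D.cur.rem - 1) D.cur.par)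
    (w, .notifier .arrive x) D.cur.node (fun _ => .idle) (fun f => .waiting .arrive f.rem f.par)
    (fun r _ => ⟨none, by simp [State.step, hr, hno], rfl⟩)
    (fun r _ _ => ⟨none, rfl, rfl⟩) (fun r _ _ => ⟨none, rfl, rfl⟩)
    (fun r f _ _ => by simp [State.step, hno])
  have hno' : ∀ r, (((c2.round P label).round P label).obs r).increase = false := fun r =>
    Swarm.not_increase (occupancy_le (Snap.mono S4 S3 id id id))
  have S5 := S4.round (P := P) (label := label)
    (D.cur.node, .waiting .signal (D.cur.rem - 1) D.cur.par)
    (w, .notifier .signal x) D.cur.node (fun _ => .idle) (fun f => .waiting .signal f.rem f.par)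
    (fun r _ => ⟨none, by simp [State.step, hno'], rfl⟩)
    (fun r _ _ => ⟨none, rfl, rfl⟩) (fun r _ _ => ⟨none, rfl, rfl⟩)
    (fun r f _ _ => by simp [State.step, hno'])
  exact S5.push (fun r h1 => S5.scout r h1.ge (by omega))
    (fun r h1 h2 => by omega) fun r h1 h2 => (hvac r (by omega) h2).elim

/-- A period in which the unsettled robots return to the parent of the current node. -/
theorem Search.Sim.back (hρs : ∀ i < k, ∃ r, ρ r = i)
    (hn : D.settled < k) (S : D.Sim G ρ c) (h : D.Inv P) (hr : D.cur.rem = 0) {g : Frame V}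
    {l : List (Frame V)} (hD : D.rest = g :: l) :
    Search.Sim G ρ ⟨D.settled, D.home, g, l⟩ ((Swarm.round P label)^[5] c) := by
  have hmem : D.cur ∈ D.path := by simp [path]
  have hg : g ∈ D.rest := by simp [hD]
  have hport := (h.valid _ hmem).port_lt
  have hl := h.linked
  rw [path, hD] at hl
  obtain ⟨⟨q, x, -, -, hvu, hnext, hq⟩, -⟩ := hl
  -- With `rem = 0` the link identifies the port held by the group with the parent port.
  rw [hr, Nat.add_zero, Nat.mod_eq_of_lt hport] at hq
  subst hq
  have hne : g.node ≠ D.cur.node := h.node_ne hg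
  obtain ⟨y, z, hvy, hadj, -, hyv⟩ := P.traverse_port (lt_of_le_of_lt (Nat.zero_le _) hport)
  obtain ⟨r₀, hr₀⟩ := hρs (k - 1) (by omega)
  obtain ⟨r₁, hr₁⟩ := hρs D.cur.rank ((h.rank_lt _ hmem).trans hn)
  change Search.Sim G ρ _ (((((c.round P label).round P label).round P label).round P label).round
    P label)
  have S1 := S.round (P := P) (label := label) (y, .host .scout D.cur.rem D.cur.par)
    (D.cur.node, .member .scout .scan (D.pack G true (k - 1))) D.cur.node
    (fun i => .member .scout .scan (D.pack G false i)) (fun f => .waiting .scout f.rem f.par)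
    (fun r _ => ⟨some 0, by simp [State.step, hr], by simp [hvy]⟩) (fun r _ _ => ⟨none, rfl, rfl⟩)
    (fun r _ _ => ⟨none, rfl, rfl⟩) (fun r f _ _ => rfl)
  have hdec : ∀ r, (c.out label r).2 = none → c.pos r = D.cur.node →
      ((c.round P label).obs r).decrease = true := fun r h1 h2 => by
    rw [Swarm.round_decrease h1, h2]
    refine occupancy_lt (Snap.mono S1 S (fun _ => rfl) id id) r₁ ?_ (S.host r₁ hr₁).1
    rw [(S1.host r₁ hr₁).1]
    exact hadj.ne'
  have hin : ∀ r, ρ r = D.cur.rank → ((c.round P label).obs r).inPort = some z := fun r h1 => by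
    rw [Swarm.round_inPort, Swarm.out, (S.host r h1).1, (S.host r h1).2]
    simp [State.step, hr, hvy]
  have S2 := S1.round (P := P) (label := label) (D.cur.node, .host .report D.cur.rem D.cur.par)
    (D.cur.node, .member .report .back (D.pack G true (k - 1))) D.cur.node
    (fun i => .member .report .back (D.pack G false i)) (fun f => .waiting .report f.rem f.par)
    (fun r h1 => ⟨some z, by simp [State.step, hin r h1], by simp [hyv]⟩)
    (fun r h1 h2 => ⟨none, by
      simp [State.step, hdec r (by simp [Swarm.out, (S.scout r h1 h2).2, State.step])
        (S.scout r h1 h2).1], rfl⟩)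
    (fun r h1 h2 => ⟨none, by
      simp [State.step, hdec r (by simp [Swarm.out, (S.crew r h1 h2).2, State.step])
        (S.crew r h1 h2).1], rfl⟩) (fun r f _ _ => rfl)
  generalize (c.round P label).round P label = c2 at *
  have S3 := S2.round (P := P) (label := label) (D.cur.node, .host .move D.cur.rem D.cur.par)
    (D.cur.node, .member .move .back (D.pack G true (k - 1))) D.cur.node
    (fun i => .member .move .back (D.pack G false i)) (fun f => .waiting .move f.rem f.par)
    (fun r _ => ⟨none, rfl, rfl⟩) (fun r _ _ => ⟨none, rfl, rfl⟩)
    (fun r _ _ => ⟨none, rfl, rfl⟩) (fun r f _ _ => rfl)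
  have hno : ∀ r, ((c2.round P label).obs r).increase = false := fun r =>
    Swarm.not_increase (occupancy_le (Snap.mono S3 S2 id id id))
  generalize c2.round P label = c3 at *
  have S4 := S3.round (P := P) (label := label) (D.cur.node, .idle)
    (g.node, .member .arrive .back (D.pack G true (k - 1))) g.node
    (fun i => .member .arrive .back (D.pack G false i)) (fun f => .waiting .arrive f.rem f.par)
    (fun r _ => ⟨none, by simp [State.step, hr], rfl⟩)
    (fun r _ _ => ⟨some D.cur.port, by simp [State.step, pack], by simp [hvu]⟩)
    (fun r _ _ => ⟨some D.cur.port, by simp [State.step, pack], by simp [hvu]⟩)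
    (fun r f _ _ => by simp [State.step, hno])
  have hins : ∀ r, D.settled ≤ ρ r → ((c3.round P label).obs r).inPort = some x ∧
      ((c3.round P label).obs r).degree = some (G.degree g.node) := fun r h1 => by
    by_cases h2 : ρ r + 1 = k
    · have h3 : ((c3.round P label).obs r).inPort = some x := by
        rw [Swarm.round_inPort, Swarm.out, (S3.scout r h1 h2).1, (S3.scout r h1 h2).2]
        simp [State.step, pack, hvu]
      exact ⟨h3, by rw [Swarm.round_degree h3, (S4.scout r h1 h2).1]⟩
    · have h3 : ((c3.round P label).obs r).inPort = some x := by
        rw [Swarm.round_inPort, Swarm.out, (S3.crew r h1 h2).1, (S3.crew r h1 h2).2]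
        simp [State.step, pack, hvu]
      exact ⟨h3, by rw [Swarm.round_degree h3, (S4.crew r h1 h2).1]⟩
  have hinc : ∀ r, ρ r = g.rank → ((c3.round P label).obs r).increase = true := fun r h1 => by
    rw [Swarm.round_increase (by simp [Swarm.out, (S3.wait r g hg h1).2, State.step]),
      (S3.wait r g hg h1).1]
    refine occupancy_lt (Snap.mono S3 S4 id (fun _ => rfl) (fun _ => rfl)) r₀ ?_
      (S4.scout r₀ (by omega) (by omega)).1
    rw [(S3.scout r₀ (by omega) (by omega)).1]
    exact hne.symm
  have hcore := h.toCore.pop hD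
  have hno' : ∀ r, ∀ f ∈ l, ρ r = f.rank → ((c3.round P label).obs r).increase = false :=
    fun r f hf h1 => Swarm.not_increase (by
      rw [(S4.wait r f (by simp [hD, hf]) h1).1]
      have h2 : g.node ≠ f.node := (hcore.node_ne hf).symm
      exact occupancy_le (Snap.mono S4 S3 id (fun e => absurd e h2) (fun e => absurd e h2)))
  refine (S4.pop hD h.cur_node).round _ _ _ _ _ (fun r h1 => ⟨none, ?_, rfl⟩)
    (fun r h1 h2 => ⟨none, ?_, rfl⟩) (fun r h1 h2 => ⟨none, ?_, rfl⟩) (fun r f hf h1 => ?_)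
  · simp [State.step, hinc r h1]
  -- By the link, the successor of the incoming port is the next port of `g`, which the group had
  -- not stored.
  · simp only [State.step, hins r h1, Option.getD_some, hnext]
    rfl
  · simp only [State.step, hins r h1, Option.getD_some, hnext]
    rfl
  · simp [State.step, hno' r f hf h1]

end Periods

/-! ### Termination -/

section Termination

variable {V : Type*} [Fintype V] [DecidableEq V] {G : SimpleGraph V} [DecidableRel G.Adj]
  {P : PortLabelling G} {k : ℕ} {label ρ : Fin k → ℕ}

/-- When the last robot has settled, the robots on the path become idle one after the other. -/
theorem Search.Notify.exists_idle (hρk : ∀ r, ρ r < k) (hρs : ∀ i < k, ∃ r, ρ r = i)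
    (l : List (Frame V)) : ∀ {D : Search V} {q : ℕ} {c : Swarm V k}, D.rest = l → D.Core →
    Linked P D.path → D.settled = k → D.cur.par = some q → D.Notify ρ q c →
    ∃ T ≤ 5 * l.length, ∀ r, ((Swarm.round P label)^[T] c).pos r = D.home (ρ r) ∧
      ((Swarm.round P label)^[T] c).st r = .idle := by
  induction l with
  | nil =>
    intro D q c hD _ hl _ hq
    rw [path, hD] at hl
    have hl : D.cur.par = none := hl
    simp [hq] at hl
  | cons g l ih =>
    intro D q c hD h hl hn hq S
    have hg : g ∈ D.rest := by simp [hD]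
    have hcore := h.pop hD
    rw [path, hD] at hl
    obtain ⟨⟨q', x, hq', hlt, hvu, -, -⟩, hl⟩ := hl
    obtain rfl : q = q' := Option.some.inj (hq.symm.trans hq')
    have huv : P.traverse g.node (some x) = (D.cur.node, some q) := by
      obtain ⟨w, x', h1, -, -, h2⟩ := P.traverse_port hlt
      rw [hvu] at h1
      simp only [Prod.mk.injEq, Option.some.injEq] at h1
      rw [h1.1, h1.2, h2]
    have hne : g.node ≠ D.cur.node := h.node_ne hg
    obtain ⟨r₀, hr₀⟩ := hρs D.cur.rank (hn ▸ h.rank_lt _ (by simp [path]))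
    have S1 := S.round (P := P) (label := label) (D.cur.node, .notifier .scout q)
      (D.cur.node, .idle) D.cur.node (fun _ => .idle) (fun f => .waiting .scout f.rem f.par)
      (fun r _ => ⟨none, rfl, rfl⟩) (fun r _ _ => ⟨none, rfl, rfl⟩) (fun r _ _ => ⟨none, rfl, rfl⟩)
      (fun r f _ _ => rfl)
    have S2 := S1.round (P := P) (label := label) (D.cur.node, .notifier .report q)
      (D.cur.node, .idle) D.cur.node (fun _ => .idle) (fun f => .waiting .report f.rem f.par)
      (fun r _ => ⟨none, rfl, rfl⟩) (fun r _ _ => ⟨none, rfl, rfl⟩) (fun r _ _ => ⟨none, rfl, rfl⟩)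
      (fun r f _ _ => rfl)
    have S3 := S2.round (P := P) (label := label) (g.node, .returning)
      (D.cur.node, .idle) D.cur.node (fun _ => .idle) (fun f => .waiting .move f.rem f.par)
      (fun r _ => ⟨some q, rfl, by simp [hvu]⟩) (fun r _ _ => ⟨none, rfl, rfl⟩)
      (fun r _ _ => ⟨none, rfl, rfl⟩) (fun r f _ _ => rfl)
    have hin : ∀ r, ρ r = D.cur.rank →
        ((((c.round P label).round P label).round P label).obs r).inPort = some x := fun r h1 => by
      rw [Swarm.round_inPort, Swarm.out, (S2.host r h1).1, (S2.host r h1).2]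
      simp [State.step, hvu]
    have hinc : ∀ r, ρ r = g.rank →
        ((((c.round P label).round P label).round P label).obs r).increase = true := fun r h1 => by
      rw [Swarm.round_increase (by simp [Swarm.out, (S2.wait r g hg h1).2, State.step]),
        (S2.wait r g hg h1).1]
      refine occupancy_lt (Snap.mono S2 S3 (fun _ => rfl) id id) r₀ ?_ (S3.host r₀ hr₀).1
      rw [(S2.host r₀ hr₀).1]
      exact hne.symm
    have hno : ∀ r, ∀ f ∈ D.rest, f.rank ≠ g.rank → ρ r = f.rank →
        ((((c.round P label).round P label).round P label).obs r).increase = false :=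
      fun r f hf h0 h1 => Swarm.not_increase (by
        rw [(S3.wait r f hf h1).1]
        refine occupancy_le (Snap.mono S3 S2 (fun e => absurd ?_ h0) id id)
        have e : g.node = f.node := e
        rw [h.node_eq g (List.mem_cons_of_mem _ hg), h.node_eq f (List.mem_cons_of_mem _ hf)] at e
        exact (h.home_inj _ (h.rank_lt _ (List.mem_cons_of_mem _ hg)) _
          (h.rank_lt _ (List.mem_cons_of_mem _ hf)) e).symm)
    have S4 := S3.round (P := P) (label := label) (D.cur.node, .idle) (D.cur.node, .idle)
      D.cur.node (fun _ => .idle)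
      -- Only the robot at `g` sees the visitor: it passes the news on, or becomes idle if it is at
      -- the source.
      (fun f => if f.rank = g.rank then g.par.elim .idle (.notifier .arrive)
        else .waiting .arrive f.rem f.par)
      (fun r h1 => ⟨some x, by simp [State.step, hin r h1], by simp [huv]⟩)
      (fun r _ _ => ⟨none, rfl, rfl⟩) (fun r _ _ => ⟨none, rfl, rfl⟩)
      (fun r f hf h1 => by
        by_cases h2 : f.rank = g.rank
        · have h3 : f = g := List.inj_on_of_nodup_map h.nodup (List.mem_cons_of_mem _ hf)
            (List.mem_cons_of_mem _ hg) h2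
          simp [State.step, hinc r (h1.trans h2), h3]
        · simp [State.step, hno r f hf h2 h1, h2])
    generalize hc3 : ((c.round P label).round P label).round P label = c3 at *
    -- The notifier's way home raises the occupancy only at its own node, so no waiting robot reads
    -- it as a retreat in slot `arrive`.
    have hno4 : ∀ r, ((c3.round P label).obs r).increase = false ∨ ρ r = D.cur.rank := fun r => by
      by_cases h1 : ρ r = D.cur.rank
      · exact Or.inr h1
      · refine Or.inl (Swarm.not_increase (occupancy_le ?_))
        rcases D.cases k (ρ r) with h2 | ⟨h2, -⟩ | ⟨h2, -⟩ | ⟨f, hf, h2⟩ | ⟨h2, h3⟩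
        · exact absurd h2 h1
        · have := hρk r
          omega
        · have := hρk r
          omega
        · rw [(S4.wait r f hf h2).1]
          exact Snap.mono S4 S3 (fun e => absurd e.symm (h.node_ne hf)) id id
        · rw [(S4.done r h2 h3).1]
          refine Snap.mono S4 S3 (fun e => absurd ?_ h1) id id
          have e : D.cur.node = D.home (ρ r) := e
          rw [h.cur_node] at e
          exact (h.home_inj _ (h.rank_lt _ (by simp [path])) _ h2 e).symm
    cases hpar : g.par with
    | none =>
      refine ⟨4, by simp only [List.length_cons]; omega, ?_⟩
      change ∀ r, ((((c.round P label).round P label).round P label).round P label).pos r = _ ∧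
        ((((c.round P label).round P label).round P label).round P label).st r = _
      rw [hc3]
      have hl' : l = [] := by
        cases l with
        | nil => rfl
        | cons g' l' =>
          obtain ⟨⟨_, _, h1, -⟩, -⟩ := hl
          rw [hpar] at h1
          cases h1
      intro r
      refine ⟨S4.settled_pos h rfl (hn ▸ hρk r), ?_⟩
      have hr := hρk r
      rcases D.cases k (ρ r) with h1 | ⟨h1, -⟩ | ⟨h1, -⟩ | ⟨f, hf, h1⟩ | ⟨h1, h2⟩
      · exact (S4.host r h1).2
      · omega
      · omega
      · rw [(S4.wait r f hf h1).2]
        rw [hD, hl', List.mem_singleton] at hf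
        simp [hf, hpar]
      · exact (S4.done r h1 h2).2
    | some q' =>
      have S5 := S4.round (P := P) (label := label) (D.cur.node, .idle) (D.cur.node, .idle)
        D.cur.node (fun _ => .idle)
        (fun f => if f.rank = g.rank then .notifier .signal q' else .waiting .signal f.rem f.par)
        (fun r h1 => ⟨none, rfl, rfl⟩)
        (fun r _ _ => ⟨none, rfl, rfl⟩) (fun r _ _ => ⟨none, rfl, rfl⟩)
        (fun r f hf h1 => by
          by_cases h2 : f.rank = g.rank
          · simp [State.step, hpar, h2, Slot.next]
          · have h3 := (hno4 r).resolve_right (h1 ▸ h.rank_ne hf)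
            simp [State.step, h2, h3])
      have S6 := S5.pop hD h.cur_node
      obtain ⟨T, hT, h1⟩ := ih (D := ⟨D.settled, D.home, g, l⟩) rfl hcore hl hn hpar
        { host := fun r h1 => by simpa using S6.host r h1
          scout := fun r h1 => by
            have := hρk r
            simp only at h1
            omega
          crew := fun r h1 => by
            have := hρk r
            simp only at h1
            omega
          wait := fun r f hf h1 => by
            have h2 : f.rank ≠ g.rank := hcore.rank_ne hf
            simpa [h2] using S6.wait r f hf h1
          done := S6.done }
      refine ⟨T + 5, by simp only [List.length_cons]; omega, ?_⟩
      rw [← hc3] at h1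
      exact h1

omit [Fintype V] [DecidableEq V] in
theorem Search.Core.rest_length_le {D : Search V} (h : D.Core) : D.rest.length ≤ D.settled := by
  have h1 : (D.path.map Frame.rank).toFinset ⊆ Finset.range D.settled := fun i hi => by
    simp only [List.mem_toFinset, List.mem_map] at hi
    obtain ⟨f, hf, rfl⟩ := hi
    simpa using h.rank_lt f hf
  have h2 := Finset.card_le_card h1
  rw [List.toFinset_card_of_nodup h.nodup, Finset.card_range, List.length_map, path,
    List.length_cons] at h2
  omega

/-- The depth-first search ends with idle robots at different nodes. -/
theorem Search.Sim.exists_idle (hG : G.Connected) (hk : k ≤ Fintype.card V)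
    (hρ : Function.Injective ρ) (hρk : ∀ r, ρ r < k) (hρs : ∀ i < k, ∃ r, ρ r = i) (μ : ℕ) :
    ∀ {D : Search V} {c : Swarm V k}, D.remaining G k ≤ μ → D.settled < k → D.Inv P →
    D.Sim G ρ c → ∃ T ≤ 5 * μ + 5 * k, (∀ r, ((Swarm.round P label)^[T] c).st r = .idle) ∧
      Function.Injective ((Swarm.round P label)^[T] c).pos := by
  induction μ with
  | zero =>
    intro D c hμ hn
    have : 0 < (k - D.settled) * (k + 2) := Nat.mul_pos (by omega) (by omega)
    simp only [remaining] at hμ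
    omega
  | succ μ ih =>
    intro D c hμ hn h S
    have step : ∀ {D' : Search V}, D'.remaining G k < D.remaining G k → D'.settled < k →
        D'.Inv P → D'.Sim G ρ ((Swarm.round P label)^[5] c) →
        ∃ T ≤ 5 * (μ + 1) + 5 * k, (∀ r, ((Swarm.round P label)^[T] c).st r = .idle) ∧
          Function.Injective ((Swarm.round P label)^[T] c).pos := by
      intro D' h1 h2 h3 h4
      obtain ⟨T, hT, h5⟩ := ih (by omega) h2 h3 h4
      refine ⟨T + 5, by omega, ?_⟩
      rw [Function.iterate_add_apply]
      exact h5
    have hmem : D.cur ∈ D.path := by simp [path]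
    by_cases hr : D.cur.rem = 0
    · cases hD : D.rest with
      | nil => exact absurd hD (h.rest_ne_nil hG (hn.trans_le hk) hr)
      | cons g l =>
        exact step (h.pop_remaining hn.le hD) hn (h.pop hr hD) (S.back hρs hn h hr hD)
    · obtain ⟨w, x, hvw, hadj, hx, hwv⟩ := P.traverse_port (h.valid _ hmem).port_lt
      by_cases hw : D.occ w
      · exact step (h.advance_remaining hn.le hr) hn (h.advance hr (by rw [hvw]; exact hw))
          (S.scan hρ hρs hn h.toCore hr hvw hwv hadj.ne hw)
      · have hpush := h.push hr hw hvw hx hwv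
        rcases Nat.lt_or_ge (D.settled + 1) k with hn' | hn'
        · exact step (h.push_remaining hn hr w x) hn' hpush
            (S.discover hρ hρs hn' h.toCore hr hvw hadj.ne hw)
        · have hn'' : D.settled + 1 = k := by omega
          obtain ⟨T, hT, h5⟩ := Search.Notify.exists_idle (label := label) hρk hρs _ rfl
            hpush.toCore hpush.linked hn'' rfl
            (S.finish (label := label) hρ hρk hρs hn'' h.toCore hr hvw hadj.ne hw)
          have h6 := hpush.toCore.rest_length_le
          have h7 : (D.push G w x).settled = k := hn''
          refine ⟨T + 5, by omega, ?_⟩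
          rw [Function.iterate_add_apply]
          refine ⟨fun r => (h5 r).2, fun r r' h8 => ?_⟩
          rw [(h5 r).1, (h5 r').1] at h8
          exact hρ (hpush.home_inj _ (h7 ▸ hρk r) _ (h7 ▸ hρk r') h8)

omit [DecidableEq V] in
/-- The search begins when all robots are at the source. -/
theorem Search.sim_begin {c : Swarm V k} {s : V} (hk : 2 ≤ k)
    (h : ∀ r, c.pos r = s ∧ c.st r = .begin k (G.degree s) (ρ r)) :
    Search.Sim G ρ ⟨1, fun _ => s, ⟨0, s, G.degree s, none, 0⟩, []⟩ c where
  host r hr := by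
    have h1 : ρ r = 0 := hr
    simp [h r, State.begin, h1]
  scout r h1 h2 := by
    have h1 : 1 ≤ ρ r := h1
    obtain ⟨h3, h4⟩ := h r
    rw [State.begin, if_neg (by omega)] at h4
    refine ⟨h3, h4.trans ?_⟩
    rw [show k - 1 = ρ r by omega]
    simp [pack, h2]
  crew r h1 h2 := by
    have h1 : 1 ≤ ρ r := h1
    obtain ⟨h3, h4⟩ := h r
    rw [State.begin, if_neg (by omega)] at h4
    refine ⟨h3, h4.trans ?_⟩
    simp [pack, h2]
  wait r f hf := by simp at hf
  done r h1 h2 := by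
    have h1 : ρ r < 1 := h1
    have h3 := h2 _ (List.mem_cons_self)
    simp only at h3
    omega

omit [DecidableEq V] in
theorem Search.inv_begin {s : V} (hs : 0 < G.degree s) :
    Search.Inv P ⟨1, fun _ => s, ⟨0, s, G.degree s, none, 0⟩, []⟩ where
  home_inj i hi j hj _ := by
    simp only at hi hj
    omega
  nodup := by simp [path]
  rank_lt := by simp [path]
  node_eq := by simp [path]
  linked := rfl
  valid f hf := by
    simp only [path, List.mem_singleton] at hf
    subst hf
    refine ⟨hs, le_rfl, fun w hw => Or.inr ?_⟩
    obtain ⟨p, hp, hpw⟩ := P.exists_port hw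
    refine ⟨p, hp, ?_⟩
    rw [← hpw]
    exact congrArg (fun p => (P.traverse s (some p)).1)
      ((congrArg (· % G.degree s) (Nat.zero_add p)).trans (Nat.mod_eq_of_lt hp))
  finished i hi hi' := by
    have h3 := hi' _ (List.mem_cons_self)
    simp only at hi h3
    omega

end Termination

/-! ### Memory -/

section Memory

/-- The states of the depth-first search, with bounds for the numbers in them. -/
def State.Bounded (K Δ : ℕ) : State → Prop
  | start | query _ _ _ | answer _ _ _ => False
  | idle | returning => True
  | member _ _ d => d.rank ≤ K ∧ d.settled ≤ K ∧ d.port ≤ Δ ∧ d.degree ≤ Δ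
  | host _ rem par | waiting _ rem par => rem ≤ Δ ∧ ∀ p ∈ par, p ≤ Δ
  | notifier _ p => p ≤ Δ

theorem State.Bounded.code_le {K Δ : ℕ} {st : State} (h : st.Bounded K Δ) :
    ∀ x ∈ st.code, x ≤ K + Δ + 8 := by
  have hs : ∀ s : Slot, s.code ≤ 4 := fun s => by cases s <;> simp [Slot.code]
  have hm : ∀ m : Mode, m.code ≤ 2 := fun m => by cases m <;> simp [Mode.code]
  have hb : ∀ b : Bool, b.toNat ≤ 1 := by decide
  have hp : ∀ par : Option ℕ, (∀ p ∈ par, p ≤ Δ) → portCode par ≤ Δ + 1 := fun par hpar => by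
    cases par with
    | none => simp [portCode]
    | some p => simpa [portCode] using hpar
  cases st with
  | start => exact h.elim
  | query => exact h.elim
  | answer => exact h.elim
  | idle => simp [State.code]
  | returning => simp [State.code]
  | member s m d =>
    obtain ⟨h1, h2, h3, h4⟩ := h
    have := hs s
    have := hm m
    have := hb d.scout
    simp only [State.code, List.mem_cons, List.not_mem_nil, or_false, forall_eq_or_imp, forall_eq]
    omega
  | host s rem par =>
    have := hs s
    have := hp par h.2
    have := h.1
    simp only [State.code, List.mem_cons, List.not_mem_nil, or_false, forall_eq_or_imp, forall_eq]
    omega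
  | waiting s rem par =>
    have := hs s
    have := hp par h.2
    have := h.1
    simp only [State.code, List.mem_cons, List.not_mem_nil, or_false, forall_eq_or_imp, forall_eq]
    omega
  | notifier s p =>
    have := hs s
    have : p ≤ Δ := h
    simp only [State.code, List.mem_cons, List.not_mem_nil, or_false, forall_eq_or_imp, forall_eq]
    omega

/-- The bounds persist locally, whatever the other robots do. Ports and degrees come from bounded
observations, and `settled` is incremented only when the test `rank ≤ settled` fails, so it never
exceeds the bound for `rank`. -/
theorem State.Bounded.step {K Δ x : ℕ} {o : Observation} {st : State} (h : st.Bounded K Δ)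
    (hp : ∀ p ∈ o.inPort, p < Δ) (hd : ∀ d ∈ o.degree, d ≤ Δ) :
    (st.step x o).1.Bounded K Δ := by
  have hd' : o.degree.getD 0 ≤ Δ := by
    cases ho : o.degree with
    | none => simp
    | some d => exact hd d ho
  have hp' : o.inPort.getD 0 ≤ Δ := by
    cases ho : o.inPort with
    | none => simp
    | some p => exact (hp p ho).le
  have hp'' : ∀ p ∈ o.inPort, p ≤ Δ := fun p h => (hp p h).le
  have hnext : ∀ p d, d ≤ Δ → nextPort p d ≤ Δ := fun p d hd => by
    unfold nextPort
    split_ifs <;> omega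
  cases st with
  | start => exact h.elim
  | query => exact h.elim
  | answer => exact h.elim
  | idle => trivial
  | returning => trivial
  | member s m d =>
    obtain ⟨h1, h2, h3, h4⟩ := h
    have h5 := hnext d.port _ h4
    have h6 := hnext (o.inPort.getD 0) _ hd'
    cases s <;> cases m <;> simp only [State.step] <;> (try split_ifs) <;>
      first
        | exact ⟨h1, h2, h3, h4⟩
        | exact ⟨h1, h2, h5, h4⟩
        | exact ⟨h1, h2, h6, hd'⟩
        | exact ⟨h1, by simp only; omega, h6, hd'⟩
        | exact hp'
        | exact ⟨(Nat.sub_le _ _).trans hd', hp''⟩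
  | host s rem par =>
    obtain ⟨h1, h2⟩ := h
    cases s <;> simp only [State.step] <;> (try split_ifs) <;>
      first
        | trivial
        | exact ⟨h1, h2⟩
        | exact ⟨(Nat.sub_le _ _).trans h1, h2⟩
  | waiting s rem par =>
    obtain ⟨h1, h2⟩ := h
    cases s <;> simp only [State.step] <;> (try split_ifs) <;>
      first
        | exact ⟨h1, h2⟩
        | cases par with
          | none => trivial
          | some p => exact h2 p rfl
  | notifier s p => cases s <;> trivial

variable {V : Type*} [Fintype V] [DecidableEq V] {G : SimpleGraph V} [DecidableRel G.Adj]
  {P : PortLabelling G} {k : ℕ} {label : Fin k → ℕ}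

theorem Swarm.round_bounded {K : ℕ} {c : Swarm V k} {r : Fin k}
    (h : (c.st r).Bounded K G.maxDegree) (hp : ∀ p ∈ (c.obs r).inPort, p < G.maxDegree)
    (hd : ∀ d ∈ (c.obs r).degree, d ≤ G.maxDegree) :
    ((c.round P label).st r).Bounded K G.maxDegree := by
  rw [round_st, out]
  exact h.step hp hd

theorem Swarm.round_obs_le (c : Swarm V k) (r : Fin k) :
    (∀ p ∈ ((c.round P label).obs r).inPort, p < G.maxDegree) ∧
      ∀ d ∈ ((c.round P label).obs r).degree, d ≤ G.maxDegree := by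
  refine ⟨fun p hp => ?_, fun d hd => ?_⟩
  · exact (P.inPort_lt hp).trans_le (G.degree_le_maxDegree _)
  · simp only [Swarm.round] at hd
    split_ifs at hd with h
    · rw [Option.mem_def, Option.some.injEq] at hd
      exact hd ▸ G.degree_le_maxDegree _
    · simp at hd

/-- Boundedness is assumed after one round because the observations in an arbitrary `c` need not be
bounded, while those made by a round are. -/
theorem Swarm.iterate_bounded {K : ℕ} {c : Swarm V k}
    (h : ∀ r, (((c.round P label)).st r).Bounded K G.maxDegree) (t : ℕ) (r : Fin k) :
    (((Swarm.round P label)^[t + 1] c).st r).Bounded K G.maxDegree := by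
  induction t with
  | zero => exact h r
  | succ t ih =>
    rw [Function.iterate_succ_apply']
    rw [Function.iterate_succ_apply'] at ih ⊢
    obtain ⟨h1, h2⟩ := ((Swarm.round P label)^[t] c).round_obs_le (P := P) (label := label) r
    exact round_bounded ih h1 h2

end Memory

/-! ### The bounds -/

section Bounds

theorem half_le_log_two : (1 : ℝ) / 2 ≤ Real.log 2 := by
  linarith [Real.log_two_gt_d9]

theorem half_le_log_add_two (n : ℕ) : (1 : ℝ) / 2 ≤ Real.log (n + 2) :=
  half_le_log_two.trans (Real.log_le_log (by norm_num) (by linarith [n.cast_nonneg (α := ℝ)]))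

theorem natLog_le (L : ℕ) : (Nat.log 2 (2 * (L + 1)) : ℝ) ≤ 4 * Real.log (L + 2) := by
  have h1 : (2 : ℝ) ^ Nat.log 2 (2 * (L + 1)) ≤ ((L : ℝ) + 2) ^ 2 := by
    have h2 : 2 ^ Nat.log 2 (2 * (L + 1)) ≤ (L + 2) ^ 2 :=
      (Nat.pow_log_le_self 2 (by omega)).trans (by nlinarith)
    exact_mod_cast h2
  have h3 := Real.log_le_log (by positivity) h1
  rw [Real.log_pow, Real.log_pow] at h3
  have h4 := mul_le_mul_of_nonneg_left half_le_log_two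
    (Nat.cast_nonneg (α := ℝ) (Nat.log 2 (2 * (L + 1))))
  push_cast at h3
  linarith

theorem State.memory_length_le_log {L Δ : ℕ} {st : State}
    (h : ∀ x ∈ st.code, x ≤ 2 * L + Δ + 8) :
    (st.memory.length : ℝ) ≤ 100000 * (Real.log (L + 2) + Real.log (Δ + 2)) := by
  have hL := half_le_log_add_two L
  have hΔ := half_le_log_add_two Δ
  have hL0 := L.cast_nonneg (α := ℝ)
  have hΔ0 := Δ.cast_nonneg (α := ℝ)
  have h1 := State.memory_length_le h
  -- This is `2 * L + Δ + 10 ≤ 4 * (L + 2) * (Δ + 2)` in logarithmic form.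
  have h2 : Real.log (((2 * L + Δ + 8 : ℕ) : ℝ) + 2) ≤
      2 * Real.log 2 + (Real.log (L + 2) + Real.log (Δ + 2)) := by
    rw [← Real.log_mul (by positivity) (by positivity),
      show (2 : ℝ) * Real.log 2 = Real.log (2 ^ 2) by rw [Real.log_pow]; norm_num,
      ← Real.log_mul (by norm_num) (by positivity)]
    refine Real.log_le_log (by positivity) ?_
    push_cast
    nlinarith [mul_nonneg hL0 hΔ0]
  have h3 := half_le_log_two
  have h4 : Real.log 2 ≤ 1 := by linarith [Real.log_two_lt_d9]
  have h5 : (3 : ℝ) ^ 8 * Real.log (((2 * L + Δ + 8 : ℕ) : ℝ) + 2) / Real.log 2 ≤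
      3 ^ 8 * (2 * 1 + (Real.log (L + 2) + Real.log (Δ + 2))) * 2 := by
    rw [div_le_iff₀ (by linarith)]
    have : 0 ≤ Real.log (L + 2) + Real.log ((Δ : ℝ) + 2) := by linarith
    nlinarith
  linarith

/-- The search itself takes O(k²) rounds, independently of Δ; the factor `Real.log (Δ + 2)` enters
only through its lower bound 1/2. -/
theorem rounds_le {L Δ k T : ℕ} (hk : 1 ≤ k)
    (hT : T ≤ 1 + 2 * (Nat.log 2 (2 * (L + 1)) + 1 + k * (Nat.log 2 (2 * (L + 1)) + 1)) +
      (5 * ((k - 1) * (k + 2) + (k + 1)) + 5 * k)) :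
    (T : ℝ) ≤ 100000 * (k * Real.log (L + 2) + (k : ℝ) ^ 2 * Real.log (Δ + 2)) := by
  have h1 : T ≤ 4 * (k * (Nat.log 2 (2 * (L + 1)) + 1)) + 31 * k ^ 2 := by
    obtain ⟨k, rfl⟩ := Nat.exists_eq_add_of_le' hk
    refine hT.trans ?_
    rw [Nat.add_sub_cancel]
    nlinarith [Nat.zero_le (k * Nat.log 2 (2 * (L + 1)))]
  have h2 : (T : ℝ) ≤ 4 * (k * (Nat.log 2 (2 * (L + 1)) + 1)) + 31 * (k : ℝ) ^ 2 := by
    exact_mod_cast h1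
  have h3 := natLog_le L
  have h4 := half_le_log_add_two L
  have h5 := half_le_log_add_two Δ
  have h6 : (k : ℝ) * (Nat.log 2 (2 * (L + 1)) + 1) ≤ k * (6 * Real.log (L + 2)) :=
    mul_le_mul_of_nonneg_left (by linarith) k.cast_nonneg
  have h7 := mul_le_mul_of_nonneg_left h5 (sq_nonneg (k : ℝ))
  have h8 := mul_le_mul_of_nonneg_left h4 (k.cast_nonneg (α := ℝ))
  have h9 := k.cast_nonneg (α := ℝ)
  nlinarith [sq_nonneg (k : ℝ)]

end Bounds

/-! ### Assembling ranking and search -/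

section Main

variable {V : Type*} [Fintype V] [DecidableEq V] {G : SimpleGraph V} [DecidableRel G.Adj]
  (P : PortLabelling G) {k : ℕ} (label : Fin k → ℕ)

/-- A single robot is idle after the first round. -/
theorem Swarm.after_one (s : V) (hk : k = 1) (r : Fin k) :
    ((Swarm.init G s k).round P label).st r = .idle := by
  simp [round_st, out, init, initial, State.step, hk]

/-- Two or more robots ask the first question after the first round. -/
theorem Swarm.asking_init (s : V) (hk : k ≠ 1) :
    ((Swarm.init G s k).round P label).Asking G s (.double 0) fun _ => 0 := fun r => by
  rw [round_pos, round_st, out]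
  simp [init, initial, State.step, hk]

variable {label} {L : ℕ}

theorem countBelow_surjective (hl : Function.Injective label) :
    ∀ i < k, ∃ r, countBelow label (label r) = i := fun i hi => by
  have h1 : Function.Injective fun r => (⟨countBelow label (label r),
      countBelow_lt label le_rfl⟩ : Fin k) := fun r r' h =>
    countBelow_label_injective label hl (Fin.mk.inj h)
  obtain ⟨r, hr⟩ := Finite.surjective_of_injective h1 ⟨i, hi⟩
  exact ⟨r, Fin.mk.inj hr⟩

theorem card_le_of_label_le (hl : Function.Injective label) (hL : ∀ r, label r ≤ L) :
    k ≤ L + 1 := by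
  simpa using Fintype.card_le_of_injective (fun r => (⟨label r, Nat.lt_succ_of_le (hL r)⟩ :
    Fin (L + 1))) fun r r' h => hl (Fin.mk.inj h)

/-- Two or more robots disperse. -/
theorem Swarm.exists_idle (hG : G.Connected) (hkV : k ≤ Fintype.card V)
    (hl : Function.Injective label) (hL : ∀ r, label r ≤ L) (s : V) (hk : 2 ≤ k) :
    (∃ T ≤ 1 + 2 * (Nat.log 2 (2 * (L + 1)) + 1 + k * (Nat.log 2 (2 * (L + 1)) + 1)) +
        (5 * ((k - 1) * (k + 2) + (k + 1)) + 5 * k),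
      (∀ r, (Swarm.after P label s T).st r = .idle) ∧
        Function.Injective (Swarm.after P label s T).pos) ∧
    ∀ t r, ∀ x ∈ ((Swarm.after P label s t).st r).code, x ≤ 2 * L + G.maxDegree + 8 := by
  have : Nontrivial V := Fintype.one_lt_card_iff_nontrivial.1 (by omega)
  have hs : 0 < G.degree s := hG.preconnected.degree_pos_of_nontrivial s
  have hΔ := G.degree_le_maxDegree s
  have hkL := card_le_of_label_le hl hL
  obtain ⟨T₁, hT₁, h1, h2⟩ := (Swarm.asking_init P label s (by omega)).exists_begin (P := P)
    hs hl hL hkL (by omega) _ le_rfl (show Query.Valid label L (.double 0) (fun _ => 0) from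
      ⟨by simp only [pow_zero]; omega, fun _ => rfl⟩)
  have hsim := Search.sim_begin (ρ := fun r => countBelow label (label r)) hk h1
  obtain ⟨T₂, hT₂, h3, h4⟩ := hsim.exists_idle (P := P) (label := label) hG hkV
    (countBelow_label_injective label hl) (fun r => countBelow_lt label le_rfl)
    (countBelow_surjective hl) _ le_rfl (show 1 < k from hk) (Search.inv_begin hs)
  have hrem : (Query.double 0).remaining L k =
      Nat.log 2 (2 * (L + 1)) + 1 + k * (Nat.log 2 (2 * (L + 1)) + 1) := rfl
  have hrem' : Search.remaining G k ⟨1, fun _ => s, ⟨0, s, G.degree s, none, 0⟩, []⟩ =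
      (k - 1) * (k + 2) + (k + 1) := by
    simp [Search.remaining, Search.path]
  rw [hrem] at hT₁
  rw [hrem'] at hT₂
  refine ⟨⟨T₂ + (T₁ + 1), by omega, ?_⟩, fun t r => ?_⟩
  · rw [after, Function.iterate_add_apply]
    exact ⟨h3, h4⟩
  · rcases Nat.lt_or_ge t (T₁ + 1) with ht | ht
    · cases t with
      | zero => simp [after, init, State.code]
      | succ t =>
        intro x hx
        exact (h2 t (by omega) r x hx).trans (by omega)
    · obtain ⟨t, rfl⟩ := Nat.exists_eq_add_of_le' ht
      -- Ranks are at most `k ≤ L + 1`, hence `K = L + 1`. The resulting bound `L + 1 + Δ + 8` fits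
      -- into `2 * L + Δ + 8`, since `2 ≤ k` forces `1 ≤ L`.
      have hb := iterate_bounded (P := P) (label := label) (K := L + 1)
        (c := (Swarm.round P label)^[T₁] (Swarm.init G s k)) (fun r => by
          rw [← Function.iterate_succ_apply' (Swarm.round P label), Function.iterate_succ_apply,
            (h1 r).2, State.begin]
          have := countBelow_le label (label r)
          split_ifs
          · exact ⟨hΔ, by simp⟩
          · exact ⟨by simp only; omega, by simp, Nat.zero_le _, hΔ⟩) t r
      rw [← Function.iterate_add_apply, show t + 1 + T₁ = t + (T₁ + 1) by omega] at hb
      exact fun x hx => (hb.code_le x hx).trans (by omega)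

end Main

end SilentDispersion

theorem mainTheorem1 :
    ∃ (A : SilentDispersion.Algorithm) (C : ℝ),
      ∀ (V : Type*) [Fintype V] [DecidableEq V] (G : SimpleGraph V) [DecidableRel G.Adj]
        (P : SilentDispersion.PortLabelling G) (s : V) (k L : ℕ) (label : Fin k → ℕ),
        G.Connected →
        k ≤ Fintype.card V →
        Function.Injective label →
        (∀ r, label r ≤ L) →
        (∃ T : ℕ,
          (T : ℝ) ≤ C * (k * Real.log (L + 2) + (k : ℝ) ^ 2 * Real.log (G.maxDegree + 2)) ∧
          A.Terminated (A.run P s label T) ∧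
          SilentDispersion.Dispersed (A.run P s label T)) ∧
        ∀ (t : ℕ) (r : Fin k),
          (((A.run P s label t).mem r).length : ℝ) ≤
            C * (Real.log (L + 2) + Real.log (G.maxDegree + 2)) := by
  refine ⟨SilentDispersion.algorithm, 100000, fun V _ _ G _ P s k L label hG hkV hl hL => ?_⟩
  have hterm : ∀ T, (∀ r, (SilentDispersion.Swarm.after P label s T).st r = .idle) →
      SilentDispersion.algorithm.Terminated (SilentDispersion.algorithm.run P s label T) :=
    fun T h r => by
      rw [SilentDispersion.algorithm_run]
      exact (SilentDispersion.algorithm_idle _).2 (h r)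
  have hmem : (∀ t r, ∀ x ∈ ((SilentDispersion.Swarm.after P label s t).st r).code,
      x ≤ 2 * L + G.maxDegree + 8) → ∀ (t : ℕ) (r : Fin k),
        (((SilentDispersion.algorithm.run P s label t).mem r).length : ℝ) ≤
          100000 * (Real.log (L + 2) + Real.log (G.maxDegree + 2)) := fun h t r => by
    rw [SilentDispersion.algorithm_run]
    exact SilentDispersion.State.memory_length_le_log (h t r)
  rcases Nat.lt_or_ge k 2 with hk | hk
  -- Fewer than two robots are treated apart: the ranking needs a port at the source, and a graph
  -- with a single node has none.
  · interval_cases k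
    · exact ⟨⟨0, by simp, fun r => r.elim0, fun r => r.elim0⟩, fun t r => r.elim0⟩
    · have hidle : ∀ t r, (SilentDispersion.Swarm.after P label s (t + 1)).st r = .idle := by
        intro t r
        induction t with
        | zero => exact SilentDispersion.Swarm.after_one P label s rfl r
        | succ t ih =>
          rw [SilentDispersion.Swarm.after, Function.iterate_succ_apply',
            SilentDispersion.Swarm.round_st, SilentDispersion.Swarm.out]
          rw [SilentDispersion.Swarm.after] at ih
          rw [ih]
          rfl
      refine ⟨⟨1, SilentDispersion.rounds_le le_rfl (by omega), hterm 1 (hidle 0),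
        fun r r' _ => Subsingleton.elim r r'⟩, hmem fun t r => ?_⟩
      cases t with
      | zero => simp [SilentDispersion.Swarm.after, SilentDispersion.Swarm.init,
          SilentDispersion.State.code]
      | succ t => simp [hidle t r, SilentDispersion.State.code]
  · obtain ⟨⟨T, hT, h1, h2⟩, h3⟩ :=
      SilentDispersion.Swarm.exists_idle P hG hkV hl hL s hk
    refine ⟨⟨T, SilentDispersion.rounds_le (by omega) hT, hterm T h1, ?_⟩, hmem h3⟩
    rw [SilentDispersion.Dispersed, SilentDispersion.algorithm_run]
    exact h2
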